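/- Let $(\Omega,\mu)$ be a probability space and let $F$ be a class of measurable real-valued functions on $\Omega$. For a function $f$ and $p\ge 1$ put $\|f\|_{(p)}=\sup_{1\le q\le p}\|f\|_{L_q(\mu)}/\sqrt q\in[0,\infty]$. An admissible sequence of $F$ is a sequence of subsets $F_s\subset F$, $s\ge 0$, with $|F_0|=1$ and $|F_s|\le 2^{2^s}$ for $s\ge 1$. For an integer $s_0\ge 0$ and $u\ge 1$ set $$ \tilde\Lambda_{s_0,u}(F)=\inf\Big(\sup_{f\in F}\sum_{s\ge s_0}2^{s/2}\|f-\pi_sf\|_{(u^22^s)}+2^{s_0/2}\sup_{f\in F}\|\pi_{s_0}f\|_{(u^22^{s_0})}\Big), $$ where the infimum is taken over all admissible sequences $(F_s)_{s\ge0}$ of $F$ and all choices of maps $\pi_s$ for which $\pi_sf$ is a nearest point to $f$ in $F_s$ with respect to $\|\cdot\|_{(u^22^s)}$. For a random variable $\xi$ let $\|\xi\|_{\psi_2}=\inf\{c>0:\mathbb E\exp(|\xi/c|^2)\le 2\}$. There exist absolute constants $c_1,c_2>0$ for which the following holds. Let $X$ be distributed according to $\mu$, let $\xi$ be a real random variable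 with $\|\xi\|_{\psi_2}<\infty$, which need not be independent of $X$, and let $(X_1,\xi_1),\dots,(X_N,\xi_N)$ be independent copies of $(X,\xi)$. Then for every integer $s_0\ge 0$ and all $u,w\ge 8$, with probability at least $$1-2\exp(-c_1u^22^{s_0})-2\exp(-c_1Nw^2),$$ one has $$ \sup_{f\in G}\Big|\sum_{i=1}^N\big(\xi_if(X_i)-\mathbb E\,\xi f(X)\big)\Big|\le c_2\,u\,w\,\sqrt N\,\|\xi\|_{\psi_2}\,\tilde\Lambda_{s_0,u}(F). $$ Here $G=F$ if the supremum over $F$ is almost surely equal to the supremum over some countable subclass of $F$ (in particular if $F$ is countable). For general $F$ the bound holds for every $G\subset F$ with that property, in particular for every countable $G\subset F$. (The conventions are $\inf\emptyset=\infty$ and $0\cdot\infty=0$.) -/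

import Mathlib

open MeasureTheory ProbabilityTheory
open scoped ENNReal

/-- The Orlicz norm `‖f‖_{ψ_α} = inf {c > 0 : 𝔼 exp (|f / c| ^ α) ≤ 2}`, with values in `[0, ∞]`
(the infimum of the empty set is `∞`), so that `f ∈ L_{ψ_α}` means `psiNorm α f μ < ∞`. -/
noncomputable def psiNorm {Ω : Type*} [MeasurableSpace Ω] (α : ℝ) (f : Ω → ℝ) (μ : Measure Ω) :
    ℝ≥0∞ :=
  ⨅ (c : ℝ) (_ : 0 < c) (_ : ∫⁻ ω, ENNReal.ofReal (Real.exp (|f ω / c| ^ α)) ∂μ ≤ 2),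
    ENNReal.ofReal c

/-- The graded norm `‖f‖_{(p)} = sup_{1 ≤ q ≤ p} ‖f‖_{L_q} / √q`, with values in `[0, ∞]`. -/
noncomputable def gradedNorm {E : Type*} [MeasurableSpace E] (p : ℝ) (f : E → ℝ) (μ : Measure E) :
    ℝ≥0∞ :=
  ⨆ q ∈ Set.Icc (1 : ℝ) p, eLpNorm f (ENNReal.ofReal q) μ / ENNReal.ofReal (Real.sqrt q)

/-- `(T_s)_{s ≥ 0}` is an admissible sequence of `F`: each `T_s` is a subset of `F`, `|T_0| = 1`, and
`|T_s| ≤ 2 ^ (2 ^ s)` for `s ≥ 1`. -/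
structure IsAdmissibleSeq {α : Type*} (F : Set α) (T : ℕ → Set α) : Prop where
  subset : ∀ s, T s ⊆ F
  card_zero : (T 0).encard = 1
  card_le : ∀ s, 1 ≤ s → (T s).encard ≤ 2 ^ (2 ^ s)

/-- `π` is a family of nearest point maps: for every `s` and every `f ∈ F`, `π_s f` is a point
of `T_s` that is nearest to `f` with respect to the norm `‖ ‖_{(u² 2^s)}`. -/
def IsNearestPointMaps {E : Type*} [MeasurableSpace E] (μ : Measure E) (u : ℝ) (F : Set (E → ℝ))
    (T : ℕ → Set (E → ℝ)) (π : ℕ → (E → ℝ) → (E → ℝ)) : Prop :=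
  ∀ s, ∀ f ∈ F, π s f ∈ T s ∧
    ∀ g ∈ T s, gradedNorm (u ^ 2 * 2 ^ s) (f - π s f) μ ≤ gradedNorm (u ^ 2 * 2 ^ s) (f - g) μ

/-- The complexity parameter
`Λ̃_{s₀,u}(F) = inf (sup_f ∑_{s ≥ s₀} 2^{s/2} ‖f - π_s f‖_{(u² 2^s)}
  + 2^{s₀/2} sup_f ‖π_{s₀} f‖_{(u² 2^{s₀})})`,
where the infimum is over all admissible sequences of `F` (and their nearest point maps).
The sum over `s ≥ s₀` is written with `s = s₀ + k`. -/
noncomputable def LambdaTilde {E : Type*} [MeasurableSpace E] (μ : Measure E) (s₀ : ℕ) (u : ℝ)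
    (F : Set (E → ℝ)) : ℝ≥0∞ :=
  ⨅ (T : ℕ → Set (E → ℝ)) (_ : IsAdmissibleSeq F T)
    (π : ℕ → (E → ℝ) → (E → ℝ)) (_ : IsNearestPointMaps μ u F T π),
    (⨆ f ∈ F, ∑' k : ℕ, (2 : ℝ≥0∞) ^ (((s₀ + k : ℕ) : ℝ) / 2) *
        gradedNorm (u ^ 2 * 2 ^ (s₀ + k)) (f - π (s₀ + k) f) μ) +
      (2 : ℝ≥0∞) ^ ((s₀ : ℝ) / 2) * ⨆ f ∈ F, gradedNorm (u ^ 2 * 2 ^ s₀) (π s₀ f) μ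

/-- The centred multiplier process `f ↦ ∑_{i=1}^N (ξ_i f(X_i) - 𝔼 ξ f(X))`; here `(X, ξ)` lives on
`(Ω₀, P₀)` and the `(X_i, ξ_i)` live on `Ω`. -/
noncomputable def multiplierSum {Ω₀ Ω E : Type*} [MeasurableSpace Ω₀] (P₀ : Measure Ω₀)
    (X : Ω₀ → E) (ξ : Ω₀ → ℝ) {N : ℕ} (Xs : Fin N → Ω → E) (ξs : Fin N → Ω → ℝ)
    (f : E → ℝ) (ω : Ω) : ℝ :=
  ∑ i, (ξs i ω * f (Xs i ω) - ∫ ω₀, ξ ω₀ * f (X ω₀) ∂P₀)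

/-- The supremum of `|Z_f|` over `f ∈ G` is almost surely equal to the supremum over a countable
subset of `G`. This is the usual separability convention for suprema of processes; it holds
trivially when `G` is countable. -/
def SupCountablyDetermined {Ω ι : Type*} [MeasurableSpace Ω] (P : Measure Ω) (Z : ι → Ω → ℝ)
    (G : Set ι) : Prop :=
  ∃ D ⊆ G, D.Countable ∧
    ∀ᵐ ω ∂P, ⨆ f ∈ G, ENNReal.ofReal |Z f ω| = ⨆ f ∈ D, ENNReal.ofReal |Z f ω|

open Filter Topology
open scoped Nat

/-- Moments of a sum of independent variables are controlled by the truncated exponential moment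
generating sums of the summands. -/
theorem integrable_pow_sum_and_moment_le {Ω ι : Type*} [MeasurableSpace Ω] {P : Measure Ω}
    [IsProbabilityMeasure P] {Y : ι → Ω → ℝ} (hind : iIndepFun Y P)
    (hm : ∀ i, AEMeasurable (Y i) P) {m : ℕ} {l K : ℝ} (hl : 0 ≤ l)
    (hint : ∀ i, ∀ k ≤ m, Integrable (fun ω => Y i ω ^ k) P)
    (hK : ∀ i, ∑ k ∈ Finset.range (m + 1), |∫ ω, Y i ω ^ k ∂P| / k ! * l ^ k ≤ K)
    (s : Finset ι) :
    ∀ n ≤ m, Integrable (fun ω => (∑ i ∈ s, Y i ω) ^ n) P ∧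
      |∫ ω, (∑ i ∈ s, Y i ω) ^ n ∂P| / n ! * l ^ n ≤ K ^ s.card := by
  classical
  induction s using Finset.induction_on with
  | empty =>
    intro n _
    refine ⟨by simp, ?_⟩
    rcases Nat.eq_zero_or_pos n with rfl | hn
    · simp
    · simp [hn.ne']
  | insert a s ha ih =>
    intro n hn
    have hK0 : 0 ≤ K := le_trans (Finset.sum_nonneg fun k _ => by positivity) (hK a)
    have hI : IndepFun (fun ω => ∑ i ∈ s, Y i ω) (Y a) P := by
      have := hind.indepFun_finsetSum_of_notMem₀ hm ha
      convert this using 1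
      ext ω; simp
    have hpow : ∀ j k : ℕ, IndepFun (fun ω => Y a ω ^ j) (fun ω => (∑ i ∈ s, Y i ω) ^ k) P :=
      fun j k => hI.symm.comp (measurable_id.pow_const j : Measurable fun x : ℝ => x ^ j)
        (measurable_id.pow_const k : Measurable fun x : ℝ => x ^ k)
    have hprod : ∀ k ∈ Finset.range (n + 1),
        Integrable (fun ω => Y a ω ^ k * (∑ i ∈ s, Y i ω) ^ (n - k) * (n.choose k : ℝ)) P := by
      intro k hk
      have hk' : k ≤ n := Nat.lt_succ_iff.mp (Finset.mem_range.mp hk)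
      exact ((hpow k (n - k)).integrable_mul (hint a k (hk'.trans hn))
        (ih (n - k) ((Nat.sub_le n k).trans hn)).1).mul_const _
    have hexp : (fun ω => (∑ i ∈ insert a s, Y i ω) ^ n) = fun ω =>
        ∑ k ∈ Finset.range (n + 1),
          Y a ω ^ k * (∑ i ∈ s, Y i ω) ^ (n - k) * (n.choose k : ℝ) := by
      ext ω
      rw [Finset.sum_insert ha, add_pow]
    rw [hexp]
    refine ⟨integrable_finsetSum _ hprod, ?_⟩
    rw [integral_finsetSum _ hprod, Finset.card_insert_of_notMem ha]
    have hterm : ∀ k ∈ Finset.range (n + 1),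
        |∫ ω, Y a ω ^ k * (∑ i ∈ s, Y i ω) ^ (n - k) * (n.choose k : ℝ) ∂P| / n ! * l ^ n ≤
          (|∫ ω, Y a ω ^ k ∂P| / k ! * l ^ k) * K ^ s.card := by
      intro k hk
      have hk' : k ≤ n := Nat.lt_succ_iff.mp (Finset.mem_range.mp hk)
      have h1 := (ih (n - k) ((Nat.sub_le n k).trans hn)).2
      rw [integral_mul_const, (hpow k (n - k)).integral_fun_mul_eq_mul_integral
        (hint a k (hk'.trans hn)).aestronglyMeasurable
        (ih (n - k) ((Nat.sub_le n k).trans hn)).1.aestronglyMeasurable, abs_mul, abs_mul,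
        Nat.abs_cast]
      refine le_trans (le_of_eq ?_) (mul_le_mul_of_nonneg_left h1 (by positivity))
      rw [Nat.cast_choose ℝ hk']
      have e : l ^ n = l ^ k * l ^ (n - k) := by rw [← pow_add, Nat.add_sub_cancel' hk']
      rw [e]
      have := Nat.factorial_ne_zero n
      field_simp
    calc _ ≤ (∑ k ∈ Finset.range (n + 1),
          |∫ ω, Y a ω ^ k * (∑ i ∈ s, Y i ω) ^ (n - k) * (n.choose k : ℝ) ∂P|) / n ! * l ^ n := by
          gcongr
          exact Finset.abs_sum_le_sum_abs _ _
      _ = ∑ k ∈ Finset.range (n + 1),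
          |∫ ω, Y a ω ^ k * (∑ i ∈ s, Y i ω) ^ (n - k) * (n.choose k : ℝ) ∂P| / n ! * l ^ n := by
          rw [Finset.sum_div, Finset.sum_mul]
      _ ≤ ∑ k ∈ Finset.range (n + 1), (|∫ ω, Y a ω ^ k ∂P| / k ! * l ^ k) * K ^ s.card :=
          Finset.sum_le_sum hterm
      _ ≤ ∑ k ∈ Finset.range (m + 1), (|∫ ω, Y a ω ^ k ∂P| / k ! * l ^ k) * K ^ s.card :=
          Finset.sum_le_sum_of_subset_of_nonneg
            (Finset.range_subset_range.mpr (Nat.succ_le_succ hn)) fun k _ _ => by positivity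
      _ = (∑ k ∈ Finset.range (m + 1), |∫ ω, Y a ω ^ k ∂P| / k ! * l ^ k) * K ^ s.card := by
          rw [Finset.sum_mul]
      _ ≤ K * K ^ s.card := by gcongr; exact hK a
      _ = K ^ (s.card + 1) := by ring

theorem natCast_pow_self_le (k : ℕ) : (k : ℝ) ^ k ≤ 3 ^ k * k ! := by
  have h := Real.pow_div_factorial_le_exp (k : ℝ) (Nat.cast_nonneg k) k
  rw [div_le_iff₀ (by positivity)] at h
  refine h.trans ?_
  gcongr
  rw [← Real.exp_one_pow]
  gcongr
  exact Real.exp_one_lt_three.le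

theorem integrable_exp_sq_of_lintegral_le {Ω : Type*} [MeasurableSpace Ω] {P : Measure Ω}
    {ξ : Ω → ℝ} {c : ℝ} (hξ : Measurable ξ)
    (h : ∫⁻ ω, ENNReal.ofReal (Real.exp (|ξ ω / c| ^ (2 : ℝ))) ∂P ≤ 2) :
    Integrable (fun ω => Real.exp ((ξ ω / c) ^ 2)) P ∧
      ∫ ω, Real.exp ((ξ ω / c) ^ 2) ∂P ≤ 2 := by
  have e : ∀ ω, |ξ ω / c| ^ (2 : ℝ) = (ξ ω / c) ^ 2 := fun ω => by
    rw [show (2 : ℝ) = ((2 : ℕ) : ℝ) by norm_num, Real.rpow_natCast, sq_abs]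
  simp only [e] at h
  have hm : Measurable fun ω => Real.exp ((ξ ω / c) ^ 2) := by fun_prop
  have hi : Integrable (fun ω => Real.exp ((ξ ω / c) ^ 2)) P := by
    refine ⟨hm.aestronglyMeasurable, ?_⟩
    rw [hasFiniteIntegral_iff_ofReal (ae_of_all _ fun ω => (Real.exp_pos _).le)]
    exact h.trans_lt (by simp)
  refine ⟨hi, ?_⟩
  rw [integral_eq_lintegral_of_nonneg_ae (ae_of_all _ fun ω => (Real.exp_pos _).le)
    hm.aestronglyMeasurable]
  exact ENNReal.toReal_le_of_le_ofReal (by norm_num) (by simpa using h)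

theorem integrable_div_pow_of_exp_sq {Ω : Type*} [MeasurableSpace Ω] {P : Measure Ω}
    {ξ : Ω → ℝ} {c : ℝ} (hξ : Measurable ξ)
    (hi : Integrable (fun ω => Real.exp ((ξ ω / c) ^ 2)) P)
    (h : ∫ ω, Real.exp ((ξ ω / c) ^ 2) ∂P ≤ 2) (k : ℕ) :
    Integrable (fun ω => (ξ ω / c) ^ (2 * k)) P ∧ ∫ ω, (ξ ω / c) ^ (2 * k) ∂P ≤ 2 * k ! := by
  have hle : ∀ ω, (ξ ω / c) ^ (2 * k) ≤ k ! * Real.exp ((ξ ω / c) ^ 2) := fun ω => by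
    have := Real.pow_div_factorial_le_exp _ (sq_nonneg (ξ ω / c)) k
    rw [div_le_iff₀ (by positivity), ← pow_mul] at this
    linarith
  have hint : Integrable (fun ω => (ξ ω / c) ^ (2 * k)) P := by
    refine (hi.const_mul (k ! : ℝ)).mono' (by fun_prop) (ae_of_all _ fun ω => ?_)
    rw [Real.norm_of_nonneg (by rw [pow_mul]; positivity)]
    exact hle ω
  refine ⟨hint, (integral_mono hint (hi.const_mul _) hle).trans ?_⟩
  rw [integral_const_mul, mul_comm]
  gcongr

theorem integrable_div_pow_of_gradedNorm_le {E : Type*} [MeasurableSpace E] {ν : Measure E}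
    {h : E → ℝ} (hh : Measurable h) {p H : ℝ} (hH : 0 < H)
    (hg : gradedNorm p h ν ≤ ENNReal.ofReal H) {k : ℕ} (hk : 1 ≤ k) (hkp : 2 * (k : ℝ) ≤ p) :
    Integrable (fun x => (h x / H) ^ (2 * k)) ν ∧
      ∫ x, (h x / H) ^ (2 * k) ∂ν ≤ 6 ^ k * k ! := by
  have hk1 : (1 : ℝ) ≤ k := by exact_mod_cast hk
  have hq : (2 * (k : ℝ)) ∈ Set.Icc (1 : ℝ) p := ⟨by linarith, hkp⟩
  have hs : 0 < Real.sqrt (2 * k) := Real.sqrt_pos.mpr (by linarith)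
  have h1 : eLpNorm h (ENNReal.ofReal (2 * k)) ν ≤
      ENNReal.ofReal (H * Real.sqrt (2 * k)) := by
    have := (le_iSup₂ (f := fun (q : ℝ) (_ : q ∈ Set.Icc (1 : ℝ) p) =>
      eLpNorm h (ENNReal.ofReal q) ν / ENNReal.ofReal (Real.sqrt q)) _ hq).trans hg
    rw [ENNReal.div_le_iff (by simpa using hs) ENNReal.ofReal_ne_top] at this
    rwa [ENNReal.ofReal_mul hH.le]
  have hmem : MemLp h (ENNReal.ofReal (2 * k)) ν :=
    ⟨hh.aestronglyMeasurable, h1.trans_lt ENNReal.ofReal_lt_top⟩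
  have hne : ENNReal.ofReal (2 * (k : ℝ)) ≠ 0 := by simp; linarith
  have hto : (ENNReal.ofReal (2 * (k : ℝ))).toReal = ((2 * k : ℕ) : ℝ) := by
    rw [ENNReal.toReal_ofReal (by positivity)]; push_cast; ring
  have hI := hmem.integrable_norm_rpow hne ENNReal.ofReal_ne_top
  have hE := hmem.eLpNorm_eq_integral_rpow_norm hne ENNReal.ofReal_ne_top
  rw [hE, ENNReal.ofReal_le_ofReal_iff (by positivity)] at h1
  rw [hto] at h1 hI
  have e1 : ∀ x, ‖h x‖ ^ ((2 * k : ℕ) : ℝ) = h x ^ (2 * k) := fun x => by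
    rw [Real.rpow_natCast, Real.norm_eq_abs, pow_mul, sq_abs, ← pow_mul]
  simp only [e1] at h1 hI
  have h2 : ∫ x, h x ^ (2 * k) ∂ν ≤ H ^ (2 * k) * (2 * k) ^ k := by
    have h0 : 0 ≤ ∫ x, h x ^ (2 * k) ∂ν := integral_nonneg fun x => by
      simp only [pow_mul]; positivity
    have := pow_le_pow_left₀ (Real.rpow_nonneg h0 _) h1 (2 * k)
    rw [Real.rpow_inv_natCast_pow h0 (by omega), mul_pow, pow_mul (Real.sqrt _),
      Real.sq_sqrt (by positivity)] at this
    exact this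
  simp only [div_pow]
  refine ⟨hI.div_const _, ?_⟩
  rw [integral_div, div_le_iff₀ (by positivity)]
  refine h2.trans ?_
  rw [mul_comm]
  gcongr
  have := natCast_pow_self_le k
  calc (2 * (k : ℝ)) ^ k = 2 ^ k * k ^ k := by rw [mul_pow]
    _ ≤ 2 ^ k * (3 ^ k * k !) := by gcongr
    _ = 6 ^ k * k ! := by rw [← mul_assoc, ← mul_pow]; norm_num

theorem integrable_abs_mul_pow {Ω : Type*} [MeasurableSpace Ω] {P : Measure Ω}
    {ξ η : Ω → ℝ} (hξ : Measurable ξ) (hη : Measurable η) {c H : ℝ} (hc : 0 < c) (hH : 0 < H)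
    {k : ℕ} (hk : 1 ≤ k) (hi : Integrable (fun ω => (ξ ω / c) ^ (2 * k)) P)
    (hb : ∫ ω, (ξ ω / c) ^ (2 * k) ∂P ≤ 2 * k !)
    (hi' : Integrable (fun ω => (η ω / H) ^ (2 * k)) P)
    (hb' : ∫ ω, (η ω / H) ^ (2 * k) ∂P ≤ 6 ^ k * k !) :
    Integrable (fun ω => |ξ ω * η ω| ^ k) P ∧
      ∫ ω, |ξ ω * η ω| ^ k ∂P ≤ k ! * (6 * c * H) ^ k := by
  have hle : ∀ ω, |ξ ω * η ω| ^ k ≤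
      (c * H) ^ k / 2 * ((ξ ω / c) ^ (2 * k) + (η ω / H) ^ (2 * k)) := fun ω => by
    have e : |ξ ω * η ω| ^ k = (c * H) ^ k * (|ξ ω / c| ^ k * |η ω / H| ^ k) := by
      rw [← mul_pow, ← mul_pow, abs_mul, abs_div, abs_div, abs_of_pos hc, abs_of_pos hH]
      congr 1
      field_simp
    have e2 : ∀ x : ℝ, x ^ (2 * k) = (|x| ^ k) ^ 2 := fun x => by
      rw [← pow_mul, mul_comm k 2, pow_mul, pow_mul, sq_abs]
    rw [e, e2, e2, div_mul_eq_mul_div, mul_div_assoc]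
    gcongr
    nlinarith [sq_nonneg (|ξ ω / c| ^ k - |η ω / H| ^ k)]
  have hint : Integrable (fun ω => |ξ ω * η ω| ^ k) P := by
    refine ((hi.add hi').const_mul ((c * H) ^ k / 2)).mono' (by fun_prop)
      (ae_of_all _ fun ω => ?_)
    rw [Real.norm_of_nonneg (by positivity)]
    exact hle ω
  refine ⟨hint, (integral_mono hint ((hi.add hi').const_mul _) hle).trans ?_⟩
  rw [integral_const_mul]
  simp only [Pi.add_apply]
  rw [integral_add hi hi']
  have h6 : (2 : ℝ) ≤ 6 ^ k := by
    calc (2 : ℝ) ≤ 6 ^ 1 := by norm_num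
      _ ≤ 6 ^ k := pow_le_pow_right₀ (by norm_num) hk
  calc _ ≤ (c * H) ^ k / 2 * (6 ^ k * k ! + 6 ^ k * k !) := by
        gcongr
        exact hb.trans (by gcongr)
    _ = k ! * (6 * c * H) ^ k := by rw [mul_assoc 6 c H, mul_pow 6]; ring

theorem measure_lt_abs_le_exp_neg {Ω : Type*} [MeasurableSpace Ω] {P : Measure Ω}
    [IsProbabilityMeasure P] {S : Ω → ℝ} {n : ℕ} (hn : Even n) {t : ℝ} (ht : 0 < t)
    (hi : Integrable (fun ω => S ω ^ n) P)
    (hS : ∫ ω, S ω ^ n ∂P ≤ (t * Real.exp (-1)) ^ n) :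
    P {ω | t < |S ω|} ≤ ENNReal.ofReal (Real.exp (-n)) := by
  have h1 := mul_meas_ge_le_integral_of_nonneg (ae_of_all P fun ω => hn.pow_nonneg (S ω)) hi
    (t ^ n)
  have h2 : P.real {ω | t ^ n ≤ S ω ^ n} ≤ Real.exp (-n) := by
    have h3 := h1.trans hS
    rw [mul_pow, ← Real.exp_nat_mul, mul_neg_one] at h3
    exact le_of_mul_le_mul_left h3 (by positivity)
  have hsub : {ω | t < |S ω|} ⊆ {ω | t ^ n ≤ S ω ^ n} := fun ω hω => by
    have := pow_le_pow_left₀ ht.le (le_of_lt hω) n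
    rwa [hn.pow_abs] at this
  refine (measure_mono hsub).trans ?_
  rw [← ENNReal.ofReal_toReal (measure_ne_top P _)]
  exact ENNReal.ofReal_le_ofReal h2

theorem sum_range_pow_le_two {x : ℝ} (hx : 0 ≤ x) (hx' : x ≤ 1 / 2) (m : ℕ) :
    ∑ k ∈ Finset.range m, x ^ k ≤ 2 :=
  (Finset.sum_le_sum fun k _ => pow_le_pow_left₀ hx hx' k).trans (sum_geometric_two_le m)

/-- A Bernstein-type tail bound for sums of independent centred variables that needs only
finitely many moments. -/
theorem measure_sum_sub_integral_le {Ω₀ Ω : Type*} [MeasurableSpace Ω₀] {P₀ : Measure Ω₀}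
    [IsProbabilityMeasure P₀] [MeasurableSpace Ω] {P : Measure Ω} [IsProbabilityMeasure P]
    {N : ℕ} {V : Fin N → Ω → ℝ} {V₀ : Ω₀ → ℝ} (hind : iIndepFun V P) (hV₀ : Measurable V₀)
    (hid : ∀ i, IdentDistrib (V i) V₀ P P₀) {n : ℕ} (hn : Even n) (hn2 : 2 ≤ n) (hnN : n ≤ N)
    {D : ℝ} (hD : 0 < D) (hV : ∀ k, 1 ≤ k → k ≤ n →
      Integrable (fun ω => |V₀ ω| ^ k) P₀ ∧ ∫ ω, |V₀ ω| ^ k ∂P₀ ≤ k ! * D ^ k) :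
    P {ω | 18 * D * Real.sqrt (n * N) < |∑ i, (V i ω - ∫ ω₀, V₀ ω₀ ∂P₀)|} ≤
      ENNReal.ofReal (Real.exp (-n)) := by
  set m := ∫ ω₀, V₀ ω₀ ∂P₀ with hmdef
  have hn0 : (0 : ℝ) < n := by exact_mod_cast (by omega : 0 < n)
  have hN0 : (0 : ℝ) < N := by exact_mod_cast (by omega : 0 < N)
  have hVi : Integrable V₀ P₀ := by
    have := (hV 1 le_rfl (by omega)).1
    simp only [pow_one] at this
    exact (integrable_norm_iff hV₀.aestronglyMeasurable).mp this
  have hmD : |m| ≤ D := by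
    have := (hV 1 le_rfl (by omega)).2
    simp only [pow_one, Nat.factorial_one, Nat.cast_one, one_mul] at this
    exact (abs_integral_le_integral_abs).trans this
  have hcent : ∀ k ≤ n, Integrable (fun ω => (V₀ ω - m) ^ k) P₀ ∧
      |∫ ω, (V₀ ω - m) ^ k ∂P₀| / k ! ≤ (2 * D) ^ k := by
    intro k hk
    rcases Nat.eq_zero_or_pos k with rfl | hk0
    · simp
    have hle : ∀ ω, |(V₀ ω - m) ^ k| ≤ 2 ^ (k - 1) * (|V₀ ω| ^ k + D ^ k) := fun ω => by
      rw [abs_pow]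
      calc |V₀ ω - m| ^ k ≤ (|V₀ ω| + D) ^ k := by
            gcongr
            exact (abs_sub _ _).trans (by gcongr)
        _ ≤ _ := add_pow_le (abs_nonneg _) hD.le k
    obtain ⟨hi, hb⟩ := hV k hk0 hk
    have hdom : Integrable (fun ω => 2 ^ (k - 1) * (|V₀ ω| ^ k + D ^ k)) P₀ :=
      (hi.add (integrable_const _)).const_mul _
    have hint : Integrable (fun ω => (V₀ ω - m) ^ k) P₀ :=
      hdom.mono' (by fun_prop) (ae_of_all _ fun ω => hle ω)
    refine ⟨hint, ?_⟩
    rw [div_le_iff₀ (by positivity)]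
    have hk1 : (1 : ℝ) ≤ k ! := by exact_mod_cast Nat.factorial_pos k
    calc |∫ ω, (V₀ ω - m) ^ k ∂P₀| ≤ ∫ ω, |(V₀ ω - m) ^ k| ∂P₀ := abs_integral_le_integral_abs
      _ ≤ ∫ ω, 2 ^ (k - 1) * (|V₀ ω| ^ k + D ^ k) ∂P₀ := integral_mono hint.abs hdom hle
      _ = 2 ^ (k - 1) * (∫ ω, |V₀ ω| ^ k ∂P₀ + D ^ k) := by
          rw [integral_const_mul, integral_add hi (integrable_const _)]; simp
      _ ≤ 2 ^ (k - 1) * (k ! * D ^ k + k ! * D ^ k) := by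
          gcongr
          exact le_mul_of_one_le_left (by positivity) hk1
      _ = (2 * D) ^ k * k ! := by
          obtain ⟨j, rfl⟩ := Nat.exists_eq_succ_of_ne_zero hk0.ne'
          simp only [Nat.succ_eq_add_one, Nat.add_sub_cancel]
          ring
  set r := Real.sqrt (n / N) with hr
  have hr0 : 0 < r := Real.sqrt_pos.mpr (by positivity)
  have hr2 : r ^ 2 = n / N := Real.sq_sqrt (by positivity)
  have hr1 : r ≤ 1 := by
    rw [hr, Real.sqrt_le_left (by norm_num), one_pow, div_le_one hN0]
    exact_mod_cast hnN
  set l := r / (4 * D) with hl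
  have hl0 : 0 < l := by positivity
  have hx : 2 * D * l = r / 2 := by rw [hl]; field_simp; norm_num
  have hYid : ∀ i, IdentDistrib (fun ω => V i ω - m) (fun ω => V₀ ω - m) P P₀ := fun i =>
    (hid i).comp (measurable_id.sub_const m)
  have hYind : iIndepFun (fun i ω => V i ω - m) P :=
    hind.comp (fun _ x => x - m) fun _ => measurable_id.sub_const m
  have hpid : ∀ i k, IdentDistrib (fun ω => (V i ω - m) ^ k) (fun ω => (V₀ ω - m) ^ k) P P₀ :=
    fun i k => (hYid i).comp (measurable_id.pow_const k)
  have hsum : ∑ k ∈ Finset.range (n + 1), |∫ ω, (V₀ ω - m) ^ k ∂P₀| / k ! * l ^ k ≤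
      1 + r ^ 2 / 2 := by
    obtain ⟨j, hj⟩ : ∃ j, n + 1 = j + 1 + 1 := ⟨n - 1, by omega⟩
    rw [hj, Finset.sum_range_succ', Finset.sum_range_succ']
    have hz : ∫ ω, (V₀ ω - m) ∂P₀ = 0 := by
      rw [integral_sub hVi (integrable_const _)]; simp [hmdef]
    have hgeo : ∑ k ∈ Finset.range j, |∫ ω, (V₀ ω - m) ^ (k + 1 + 1) ∂P₀| / (k + 1 + 1)! *
        l ^ (k + 1 + 1) ≤ (r / 2) ^ 2 * 2 := by
      calc _ ≤ ∑ k ∈ Finset.range j, (r / 2) ^ 2 * (r / 2) ^ k := by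
            refine Finset.sum_le_sum fun k hk => ?_
            have := Finset.mem_range.mp hk
            have h := (hcent (k + 1 + 1) (by omega)).2
            calc _ ≤ (2 * D) ^ (k + 1 + 1) * l ^ (k + 1 + 1) := by gcongr
              _ = (r / 2) ^ 2 * (r / 2) ^ k := by rw [← mul_pow, hx]; ring
        _ ≤ _ := by
            rw [← Finset.mul_sum]
            gcongr
            exact sum_range_pow_le_two (by positivity) (by linarith) j
    simp only [zero_add, pow_one, pow_zero, hz]
    simp
    linarith
  obtain ⟨hSi, hSb⟩ := integrable_pow_sum_and_moment_le (m := n) (l := l) (K := 1 + r ^ 2 / 2)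
    hYind (fun i => (hYid i).aemeasurable_fst) hl0.le
    (fun i k hk => (hpid i k).integrable_iff.mpr (hcent k hk).1)
    (fun i => by simp only [(hpid i _).integral_eq]; exact hsum) Finset.univ n le_rfl
  have hsq : Real.sqrt (n * N) = r * N := by
    rw [show (n * N : ℝ) = (r * N) ^ 2 by rw [mul_pow, hr2]; field_simp,
      Real.sqrt_sq (by positivity)]
  rw [hsq]
  refine measure_lt_abs_le_exp_neg hn (by positivity) hSi ?_
  have hK : (1 + r ^ 2 / 2) ^ N ≤ Real.exp (1 / 2) ^ n := by
    calc (1 + r ^ 2 / 2) ^ N ≤ Real.exp (r ^ 2 / 2) ^ N := by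
          gcongr
          linarith [Real.add_one_le_exp (r ^ 2 / 2)]
      _ = Real.exp (1 / 2) ^ n := by
          rw [← Real.exp_nat_mul, ← Real.exp_nat_mul, hr2]
          congr 1
          field_simp
  rw [Finset.card_univ, Fintype.card_fin] at hSb
  have hfac : (n ! : ℝ) ≤ n ^ n := by exact_mod_cast Nat.factorial_le_pow n
  have h1 : ∫ ω, (∑ i, (V i ω - m)) ^ n ∂P ≤ (n * Real.exp (1 / 2) / l) ^ n := by
    have := hSb.trans hK
    rw [div_mul_eq_mul_div, div_le_iff₀ (by positivity), ← le_div_iff₀ (by positivity)] at this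
    refine (le_abs_self _).trans (this.trans ?_)
    calc Real.exp (1 / 2) ^ n * n ! / l ^ n ≤ Real.exp (1 / 2) ^ n * n ^ n / l ^ n := by gcongr
      _ = (n * Real.exp (1 / 2) / l) ^ n := by
          rw [div_pow _ l, mul_pow (n : ℝ), mul_comm ((n : ℝ) ^ n)]
  refine h1.trans (pow_le_pow_left₀ (by positivity) ?_ n)
  have he : (n : ℝ) = r ^ 2 * N := by rw [hr2]; field_simp
  have e1 : n * Real.exp (1 / 2) / l = 4 * D * (r * N) * Real.exp (1 / 2) := by
    rw [he, hl]; field_simp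
  rw [e1]
  have e2 : Real.exp (1 / 2) * 4 ≤ 18 * Real.exp (-1) := by
    rw [Real.exp_neg, ← div_eq_mul_inv, le_div_iff₀ (Real.exp_pos _)]
    have h2 : Real.exp (1 / 2) ^ 2 = Real.exp 1 := by rw [← Real.exp_nat_mul]; norm_num
    have h3 := Real.exp_one_lt_d9
    have h4 : Real.exp (1 / 2) ≤ 1.65 := by
      refine (sq_le_sq₀ (Real.exp_pos _).le (by norm_num)).mp ?_
      rw [h2]; norm_num at h3 ⊢; linarith
    nlinarith [Real.exp_pos (1 / 2), Real.exp_pos 1]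
  calc 4 * D * (r * N) * Real.exp (1 / 2) = D * (r * N) * (Real.exp (1 / 2) * 4) := by ring
    _ ≤ D * (r * N) * (18 * Real.exp (-1)) := by gcongr
    _ = 18 * D * (r * N) * Real.exp (-1) := by ring

theorem measure_sum_sq_le {Ω₀ Ω : Type*} [MeasurableSpace Ω₀] {P₀ : Measure Ω₀}
    [MeasurableSpace Ω] {P : Measure Ω} [IsProbabilityMeasure P]
    {N : ℕ} {V : Fin N → Ω → ℝ} {V₀ : Ω₀ → ℝ} (hind : iIndepFun V P)
    (hid : ∀ i, IdentDistrib (V i) V₀ P P₀) [IsProbabilityMeasure P₀]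
    {n : ℕ} (hn : Even n) (hn2 : 2 ≤ n) (hnN : N ≤ n)
    (hV : ∀ k, 1 ≤ k → k ≤ n →
      Integrable (fun ω => V₀ ω ^ (2 * k)) P₀ ∧ ∫ ω, V₀ ω ^ (2 * k) ∂P₀ ≤ 6 ^ k * k !) :
    P {ω | 66 * (n : ℝ) < |∑ i, V i ω ^ 2|} ≤ ENNReal.ofReal (Real.exp (-n)) := by
  have hpid : ∀ i k, IdentDistrib (fun ω => (V i ω ^ 2) ^ k) (fun ω => (V₀ ω ^ 2) ^ k) P P₀ :=
    fun i k => (hid i).comp ((measurable_id.pow_const 2).pow_const k)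
  have hmom : ∀ k ≤ n, Integrable (fun ω => (V₀ ω ^ 2) ^ k) P₀ ∧
      |∫ ω, (V₀ ω ^ 2) ^ k ∂P₀| / k ! ≤ 6 ^ k := by
    intro k hk
    rcases Nat.eq_zero_or_pos k with rfl | hk0
    · simp
    simp only [← pow_mul]
    refine ⟨(hV k hk0 hk).1, ?_⟩
    rw [div_le_iff₀ (by positivity), abs_of_nonneg]
    · exact (hV k hk0 hk).2
    · exact integral_nonneg fun ω => by simp only [pow_mul]; positivity
  obtain ⟨hSi, hSb⟩ := integrable_pow_sum_and_moment_le (m := n) (l := 1 / 12) (K := 2)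
    (hind.comp (fun _ x => x ^ 2) fun _ => measurable_id.pow_const 2)
    (fun i => ((hid i).comp (measurable_id.pow_const 2)).aemeasurable_fst) (by norm_num)
    (fun i k hk => (hpid i k).integrable_iff.mpr (hmom k hk).1)
    (fun i => by
      simp only [Function.comp_apply, (hpid i _).integral_eq]
      refine le_trans (Finset.sum_le_sum fun k hk => ?_)
        (sum_range_pow_le_two (x := 1 / 2) (by norm_num) le_rfl (n + 1))
      have := (hmom k (Nat.lt_succ_iff.mp (Finset.mem_range.mp hk))).2
      calc _ ≤ (6 : ℝ) ^ k * (1 / 12) ^ k := by gcongr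
        _ = (1 / 2) ^ k := by rw [← mul_pow]; norm_num) Finset.univ n le_rfl
  rw [Finset.card_univ, Fintype.card_fin] at hSb
  simp only [Function.comp_apply] at hSi hSb
  have hn0 : (0 : ℝ) < n := by exact_mod_cast (by omega : 0 < n)
  refine measure_lt_abs_le_exp_neg hn (by positivity) hSi ?_
  have hfac : (n ! : ℝ) ≤ n ^ n := by exact_mod_cast Nat.factorial_le_pow n
  have hK : (2 : ℝ) ^ N ≤ 2 ^ n := pow_le_pow_right₀ (by norm_num) hnN
  have h1 : ∫ ω, (∑ i, V i ω ^ 2) ^ n ∂P ≤ (24 * n) ^ n := by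
    have := hSb.trans hK
    rw [div_mul_eq_mul_div, div_le_iff₀ (by positivity), ← le_div_iff₀ (by positivity)] at this
    refine (le_abs_self _).trans (this.trans ?_)
    calc (2 : ℝ) ^ n * n ! / (1 / 12) ^ n = 24 ^ n * n ! := by
          rw [mul_div_right_comm, ← div_pow]; norm_num
      _ ≤ 24 ^ n * n ^ n := by gcongr
      _ = (24 * n) ^ n := by rw [mul_pow]
  refine h1.trans (pow_le_pow_left₀ (by positivity) ?_ n)
  rw [Real.exp_neg, ← div_eq_mul_inv, le_div_iff₀ (Real.exp_pos _)]
  nlinarith [Real.exp_one_lt_d9]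

/-- The pairs `(Xs i, ξs i)` are independent copies of `(X, ξ)`, and `𝔼 exp ((ξ / c)²) ≤ 2`. -/
structure IsSubgaussianSample {Ω₀ Ω E : Type*} [MeasurableSpace E] [MeasurableSpace Ω₀]
    [MeasurableSpace Ω] (P₀ : Measure Ω₀) (P : Measure Ω) (X : Ω₀ → E) (ξ : Ω₀ → ℝ) {N : ℕ}
    (Xs : Fin N → Ω → E) (ξs : Fin N → Ω → ℝ) (c : ℝ) : Prop where
  measurable_left : Measurable X
  measurable_right : Measurable ξ
  indep : iIndepFun (fun i ω => (Xs i ω, ξs i ω)) P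
  ident : ∀ i, IdentDistrib (fun ω => (Xs i ω, ξs i ω)) (fun ω => (X ω, ξ ω)) P P₀
  pos : 0 < c
  exp_le : ∫⁻ ω, ENNReal.ofReal (Real.exp (|ξ ω / c| ^ (2 : ℝ))) ∂P₀ ≤ 2

namespace IsSubgaussianSample

variable {Ω₀ Ω E : Type*} [MeasurableSpace E] [MeasurableSpace Ω₀] [MeasurableSpace Ω]
  {P₀ : Measure Ω₀} {P : Measure Ω} {X : Ω₀ → E} {ξ : Ω₀ → ℝ} {N : ℕ}
  {Xs : Fin N → Ω → E} {ξs : Fin N → Ω → ℝ} {c : ℝ}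

theorem integrable_div_pow (hs : IsSubgaussianSample P₀ P X ξ Xs ξs c) {h : E → ℝ}
    (hh : Measurable h) {p H : ℝ} (hH : 0 < H)
    (hg : gradedNorm p h (P₀.map X) ≤ ENNReal.ofReal H) {k : ℕ} (hk : 1 ≤ k)
    (hkp : 2 * (k : ℝ) ≤ p) :
    Integrable (fun ω => (h (X ω) / H) ^ (2 * k)) P₀ ∧
      ∫ ω, (h (X ω) / H) ^ (2 * k) ∂P₀ ≤ 6 ^ k * k ! := by
  have hm : Measurable fun x => (h x / H) ^ (2 * k) := by fun_prop
  obtain ⟨h1, h2⟩ := integrable_div_pow_of_gradedNorm_le hh hH hg hk hkp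
  rw [integral_map hs.measurable_left.aemeasurable hm.aestronglyMeasurable] at h2
  exact ⟨h1.comp_measurable hs.measurable_left, h2⟩

theorem integrable_abs_mul_pow (hs : IsSubgaussianSample P₀ P X ξ Xs ξs c) {h : E → ℝ}
    (hh : Measurable h) {p H : ℝ} (hH : 0 < H)
    (hg : gradedNorm p h (P₀.map X) ≤ ENNReal.ofReal H) {k : ℕ} (hk : 1 ≤ k)
    (hkp : 2 * (k : ℝ) ≤ p) :
    Integrable (fun ω => |ξ ω * h (X ω)| ^ k) P₀ ∧
      ∫ ω, |ξ ω * h (X ω)| ^ k ∂P₀ ≤ k ! * (6 * c * H) ^ k := by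
  obtain ⟨e1, e2⟩ := integrable_exp_sq_of_lintegral_le hs.measurable_right hs.exp_le
  obtain ⟨a1, a2⟩ := integrable_div_pow_of_exp_sq hs.measurable_right e1 e2 k
  obtain ⟨b1, b2⟩ := hs.integrable_div_pow hh hH hg hk hkp
  exact _root_.integrable_abs_mul_pow hs.measurable_right (hh.comp hs.measurable_left) hs.pos hH
    hk a1 a2 b1 b2

theorem integrable_mul (hs : IsSubgaussianSample P₀ P X ξ Xs ξs c) {h : E → ℝ}
    (hh : Measurable h) {p H : ℝ} (hp : 2 ≤ p) (hH : 0 < H)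
    (hg : gradedNorm p h (P₀.map X) ≤ ENNReal.ofReal H) :
    Integrable (fun ω => ξ ω * h (X ω)) P₀ ∧ ∫ ω, |ξ ω * h (X ω)| ∂P₀ ≤ 6 * c * H := by
  obtain ⟨h1, h2⟩ := hs.integrable_abs_mul_pow hh hH hg (k := 1) le_rfl (by simpa using hp)
  simp only [pow_one, Nat.factorial_one, Nat.cast_one, one_mul] at h1 h2
  have := hs.measurable_left
  have := hs.measurable_right
  exact ⟨(integrable_norm_iff (by fun_prop)).mp h1, h2⟩

/-- The tail of a single centred multiplier sum on the event that the multipliers have small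
empirical second moment. -/
theorem measure_multiplierSum_le [IsProbabilityMeasure P₀] [IsProbabilityMeasure P]
    (hs : IsSubgaussianSample P₀ P X ξ Xs ξs c) {h : E → ℝ}
    (hh : Measurable h) {p H w : ℝ} (hp : 64 ≤ p) (hw : 1 ≤ w) (hH : 0 < H)
    (hg : gradedNorm p h (P₀.map X) ≤ ENNReal.ofReal H) :
    P ({ω | ∑ i, ξs i ω ^ 2 ≤ w ^ 2 * N * c ^ 2} ∩
        {ω | 54 * w * Real.sqrt N * Real.sqrt p * c * H <
          |multiplierSum P₀ X ξ Xs ξs h ω|}) ≤ ENNReal.ofReal (Real.exp (-(p / 8))) := by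
  have hc := hs.pos
  set n := 2 * ⌊p / 8⌋₊ with hn
  have hfl : (⌊p / 8⌋₊ : ℝ) ≤ p / 8 := Nat.floor_le (by positivity)
  have hfl' : p / 8 < (⌊p / 8⌋₊ : ℝ) + 1 := Nat.lt_floor_add_one _
  have hnp : (n : ℝ) ≤ p / 4 := by rw [hn]; push_cast; linarith
  have hnp' : p / 8 ≤ n := by rw [hn]; push_cast; linarith
  have hn2 : 2 ≤ n := by
    have : (2 : ℝ) ≤ n := by linarith
    exact_mod_cast this
  have heven : Even n := even_two_mul _
  refine le_trans ?_ (ENNReal.ofReal_le_ofReal (Real.exp_le_exp.mpr (neg_le_neg hnp')))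
  have hsqn : Real.sqrt n ≤ Real.sqrt p / 2 := by
    rw [show Real.sqrt p / 2 = Real.sqrt (p / 4) by
      rw [Real.sqrt_div' _ (by norm_num), show (4 : ℝ) = 2 ^ 2 by norm_num,
        Real.sqrt_sq (by norm_num)]]
    exact Real.sqrt_le_sqrt hnp
  have hkp : ∀ k : ℕ, k ≤ n → 2 * (k : ℝ) ≤ p := fun k hk => by
    have : (k : ℝ) ≤ n := by exact_mod_cast hk
    linarith
  rcases le_total n N with hnN | hnN
  · have hφ : Measurable fun z : E × ℝ => z.2 * h z.1 :=
      measurable_snd.mul (hh.comp measurable_fst)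
    have hmX := hs.measurable_left
    have hmξ := hs.measurable_right
    have key := measure_sum_sub_integral_le (V := fun i ω => ξs i ω * h (Xs i ω))
      (V₀ := fun ω => ξ ω * h (X ω)) (hs.indep.comp (fun _ z => z.2 * h z.1) fun _ => hφ)
      (by fun_prop) (fun i => (hs.ident i).comp hφ) heven hn2 hnN (D := 6 * c * H)
      (by positivity) (fun k hk hkn => hs.integrable_abs_mul_pow hh hH hg hk (hkp k hkn))
    refine (measure_mono fun ω hω => ?_).trans key
    have h54 : 54 * w * Real.sqrt N * Real.sqrt p * c * H < _ := hω.2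
    refine lt_of_le_of_lt ?_ h54
    rw [Real.sqrt_mul (Nat.cast_nonneg _)]
    calc 18 * (6 * c * H) * (Real.sqrt n * Real.sqrt N)
        ≤ 18 * (6 * c * H) * (Real.sqrt p / 2 * Real.sqrt N) := by gcongr
      _ = 54 * 1 * Real.sqrt N * Real.sqrt p * c * H := by ring
      _ ≤ _ := by gcongr
  · have hψ : Measurable fun z : E × ℝ => h z.1 / H := (hh.comp measurable_fst).div_const H
    have key := measure_sum_sq_le (V := fun i ω => h (Xs i ω) / H)
      (V₀ := fun ω => h (X ω) / H) (hs.indep.comp (fun _ z => h z.1 / H) fun _ => hψ)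
      (fun i => (hs.ident i).comp hψ) heven hn2 hnN
      (fun k hk hkn => hs.integrable_div_pow hh hH hg hk (hkp k hkn))
    refine (measure_mono fun ω hω => ?_).trans key
    by_contra hcon
    have h54 : 54 * w * Real.sqrt N * Real.sqrt p * c * H < _ := hω.2
    have hξω : ∑ i, ξs i ω ^ 2 ≤ w ^ 2 * N * c ^ 2 := hω.1
    refine absurd h54 (not_lt.mpr ?_)
    simp only [Set.mem_ofPred_eq, not_lt] at hcon
    have h1 : ∑ i, h (Xs i ω) ^ 2 ≤ 66 * n * H ^ 2 := by
      have := (le_abs_self _).trans hcon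
      simp only [div_pow] at this
      rwa [← Finset.sum_div, div_le_iff₀ (by positivity)] at this
    have h2 : |∑ i, ξs i ω * h (Xs i ω)| ≤ w * Real.sqrt N * c * (9 * Real.sqrt n * H) := by
      refine abs_le_of_sq_le_sq ?_ (by positivity)
      refine (Finset.sum_mul_sq_le_sq_mul_sq _ _ _).trans ?_
      calc _ ≤ (w ^ 2 * N * c ^ 2) * (66 * n * H ^ 2) :=
            mul_le_mul hξω h1 (Finset.sum_nonneg fun _ _ => sq_nonneg _) (by positivity)
        _ ≤ (w ^ 2 * N * c ^ 2) * (81 * n * H ^ 2) := by gcongr; norm_num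
        _ = _ := by
            simp only [mul_pow, Real.sq_sqrt (Nat.cast_nonneg _)]
            ring
    have h3 : |∫ ω₀, ξ ω₀ * h (X ω₀) ∂P₀| ≤ 6 * c * H :=
      abs_integral_le_integral_abs.trans (hs.integrable_mul hh (by linarith) hH hg).2
    have hNn : (N : ℝ) ≤ Real.sqrt N * Real.sqrt n := by
      nth_rw 1 [← Real.mul_self_sqrt (Nat.cast_nonneg N)]
      gcongr
    calc |multiplierSum P₀ X ξ Xs ξs h ω|
        = |∑ i, ξs i ω * h (Xs i ω) - N * ∫ ω₀, ξ ω₀ * h (X ω₀) ∂P₀| := by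
          simp [multiplierSum]
      _ ≤ |∑ i, ξs i ω * h (Xs i ω)| + N * |∫ ω₀, ξ ω₀ * h (X ω₀) ∂P₀| := by
          refine (abs_sub _ _).trans ?_
          rw [abs_mul, Nat.abs_cast]
      _ ≤ w * Real.sqrt N * c * (9 * Real.sqrt n * H) +
          1 * (Real.sqrt N * Real.sqrt n) * (6 * c * H) := by
          rw [one_mul]
          gcongr
      _ ≤ w * Real.sqrt N * c * (9 * Real.sqrt n * H) +
          w * (Real.sqrt N * Real.sqrt n) * (6 * c * H) := by gcongr
      _ = 15 * w * Real.sqrt N * Real.sqrt n * c * H := by ring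
      _ ≤ 108 * w * Real.sqrt N * (Real.sqrt p / 2) * c * H := by gcongr; norm_num
      _ = _ := by ring

theorem measure_lt_sum_sq_le [IsProbabilityMeasure P]
    (hs : IsSubgaussianSample P₀ P X ξ Xs ξs c) {w : ℝ} (hw : 2 ≤ w ^ 2) :
    P {ω | w ^ 2 * N * c ^ 2 < ∑ i, ξs i ω ^ 2} ≤
      ENNReal.ofReal (Real.exp (-(N * w ^ 2 / 2))) := by
  have hc := hs.pos
  obtain ⟨e1, e2⟩ := integrable_exp_sq_of_lintegral_le hs.measurable_right hs.exp_le
  have hφ : Measurable fun z : E × ℝ => (z.2 / c) ^ 2 := by fun_prop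
  have hid := fun i => (hs.ident i).comp hφ
  have hide := fun i => (hid i).comp Real.measurable_exp
  have hind : iIndepFun (fun i ω => (ξs i ω / c) ^ 2) P :=
    hs.indep.comp (fun _ z => (z.2 / c) ^ 2) fun _ => hφ
  have hprod := hind.mgf_sum₀ (t := 1) (fun i => (hid i).aemeasurable_fst) Finset.univ
  have hmgf : mgf (∑ i, fun ω => (ξs i ω / c) ^ 2) P 1 ≤ 2 ^ N := by
    rw [hprod]
    refine (Finset.prod_le_prod (fun i _ => mgf_nonneg) (g := fun _ => (2 : ℝ)) fun i _ => ?_).trans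
      (by simp)
    simp only [mgf, one_mul]
    exact ((hide i).integral_eq).trans_le e2
  have hint : Integrable (fun ω => Real.exp (1 * (∑ i, fun ω => (ξs i ω / c) ^ 2) ω)) P := by
    refine Integrable.of_integral_ne_zero (ne_of_gt ?_)
    change 0 < mgf (∑ i, fun ω => (ξs i ω / c) ^ 2) P 1
    rw [hprod]
    refine Finset.prod_pos fun i _ => mgf_pos ?_
    simp only [one_mul]
    exact (hide i).integrable_iff.mpr e1
  have hch := measure_ge_le_exp_mul_mgf (w ^ 2 * N) zero_le_one hint
  have h2 : P.real {ω | w ^ 2 * N ≤ (∑ i, fun ω => (ξs i ω / c) ^ 2) ω} ≤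
      Real.exp (-(N * w ^ 2 / 2)) := by
    refine hch.trans ?_
    calc _ ≤ Real.exp (-1 * (w ^ 2 * N)) * Real.exp 1 ^ N := by
          gcongr
          refine hmgf.trans ?_
          gcongr
          linarith [Real.add_one_le_exp 1]
      _ = Real.exp (N - w ^ 2 * N) := by
          rw [Real.exp_one_pow, ← Real.exp_add]; ring_nf
      _ ≤ _ := by
          gcongr
          nlinarith [(Nat.cast_nonneg N : (0 : ℝ) ≤ N)]
  have hsub : {ω | w ^ 2 * N * c ^ 2 < ∑ i, ξs i ω ^ 2} ⊆
      {ω | w ^ 2 * N ≤ (∑ i, fun ω => (ξs i ω / c) ^ 2) ω} := fun ω hω => by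
    simp only [Set.mem_ofPred_eq, Finset.sum_apply, div_pow] at hω ⊢
    rw [← Finset.sum_div, le_div_iff₀ (by positivity)]
    exact hω.le
  refine (measure_mono hsub).trans ?_
  rw [← ENNReal.ofReal_toReal (measure_ne_top P _)]
  exact ENNReal.ofReal_le_ofReal h2

end IsSubgaussianSample

theorem gradedNorm_mono {E : Type*} [MeasurableSpace E] {ν : Measure E} {p p' : ℝ} (hp : p ≤ p')
    (f : E → ℝ) : gradedNorm p f ν ≤ gradedNorm p' f ν :=
  biSup_mono fun _ hq => ⟨hq.1, hq.2.trans hp⟩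

theorem gradedNorm_add_le {E : Type*} [MeasurableSpace E] {ν : Measure E} {p : ℝ} {f g : E → ℝ}
    (hf : Measurable f) (hg : Measurable g) :
    gradedNorm p (f + g) ν ≤ gradedNorm p f ν + gradedNorm p g ν := by
  refine iSup₂_le fun q hq => ?_
  have h1 : 1 ≤ ENNReal.ofReal q := by simpa using hq.1
  refine (ENNReal.div_le_div_right
    (eLpNorm_add_le hf.aestronglyMeasurable hg.aestronglyMeasurable h1) _).trans ?_
  rw [ENNReal.add_div]
  exact add_le_add
    (le_iSup₂ (f := fun (q : ℝ) (_ : q ∈ Set.Icc (1 : ℝ) p) =>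
      eLpNorm f (ENNReal.ofReal q) ν / ENNReal.ofReal (Real.sqrt q)) q hq)
    (le_iSup₂ (f := fun (q : ℝ) (_ : q ∈ Set.Icc (1 : ℝ) p) =>
      eLpNorm g (ENNReal.ofReal q) ν / ENNReal.ofReal (Real.sqrt q)) q hq)

theorem gradedNorm_neg {E : Type*} [MeasurableSpace E] {ν : Measure E} {p : ℝ} (f : E → ℝ) :
    gradedNorm p (-f) ν = gradedNorm p f ν := by
  simp only [gradedNorm, eLpNorm_neg]

theorem gradedNorm_sub_le {E : Type*} [MeasurableSpace E] {ν : Measure E} {p : ℝ} {f g : E → ℝ}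
    (hf : Measurable f) (hg : Measurable g) :
    gradedNorm p (f - g) ν ≤ gradedNorm p f ν + gradedNorm p g ν := by
  rw [sub_eq_add_neg, ← gradedNorm_neg g]
  exact gradedNorm_add_le hf hg.neg

/-- Continuity from below in the threshold of a tail probability. -/
theorem measure_inter_mul_lt_le {Ω : Type*} [MeasurableSpace Ω] {P : Measure Ω} {A : Set Ω}
    {S : Ω → ℝ≥0∞} {a b δ : ℝ≥0∞} (ha : a ≠ ∞) (hab : a ≠ 0 ∨ b ≠ ∞)
    (h : ∀ b', b < b' → b' ≠ ∞ → P (A ∩ {ω | a * b' < S ω}) ≤ δ) :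
    P (A ∩ {ω | a * b < S ω}) ≤ δ := by
  rcases eq_or_ne b ∞ with rfl | hb
  · have ha0 : a ≠ 0 := hab.resolve_right (by simp)
    simp [ENNReal.mul_top ha0]
  set v : ℕ → ℝ≥0∞ := fun n => b + ((n : ℝ≥0∞) + 1)⁻¹ with hv
  have hvanti : Antitone v := fun m n hmn => by
    simp only [hv]
    gcongr
  have hvlim : Tendsto (fun n => a * v n) atTop (𝓝 (a * b)) := by
    refine ENNReal.Tendsto.const_mul ?_ (Or.inr ha)
    have h1 : Tendsto (fun n : ℕ => ((n : ℝ≥0∞) + 1)⁻¹) atTop (𝓝 0) := by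
      have := (tendsto_add_atTop_iff_nat 1).mpr ENNReal.tendsto_inv_nat_nhds_zero
      simpa using this
    simpa [hv] using (tendsto_const_nhds (x := b)).add h1
  have hmono : Monotone fun n => A ∩ {ω | a * v n < S ω} := fun m n hmn =>
    Set.inter_subset_inter_right _ fun ω (hω : a * v m < S ω) =>
      lt_of_le_of_lt (mul_le_mul_right (hvanti hmn) a) hω
  have hsub : A ∩ {ω | a * b < S ω} ⊆ ⋃ n, A ∩ {ω | a * v n < S ω} := fun ω hω => by
    obtain ⟨n, hn⟩ := (hvlim.eventually_lt_const (show a * b < S ω from hω.2)).exists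
    exact Set.mem_iUnion.mpr ⟨n, hω.1, hn⟩
  refine (measure_mono hsub).trans ?_
  rw [hmono.measure_iUnion]
  refine iSup_le fun n => h _ (ENNReal.lt_add_right hb (by simp)) ?_
  simp [hv, hb]

theorem ofReal_sqrt_sq_mul_two_pow {u : ℝ} (hu : 0 ≤ u) (s : ℕ) :
    ENNReal.ofReal (Real.sqrt (u ^ 2 * 2 ^ s)) =
      ENNReal.ofReal u * (2 : ℝ≥0∞) ^ ((s : ℝ) / 2) := by
  rw [Real.sqrt_mul (sq_nonneg u), Real.sqrt_sq hu, ENNReal.ofReal_mul hu]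
  congr 1
  rw [Real.sqrt_eq_rpow, ← Real.rpow_natCast, ← Real.rpow_mul (by norm_num),
    ← ENNReal.ofReal_rpow_of_pos (by norm_num)]
  simp [div_eq_mul_inv]

theorem IsAdmissibleSeq.encard_le {α : Type*} {F : Set α} {T : ℕ → Set α}
    (hT : IsAdmissibleSeq F T) (s : ℕ) : (T s).encard ≤ 2 ^ (2 ^ s) := by
  rcases Nat.eq_zero_or_pos s with rfl | hs
  · rw [hT.card_zero]; norm_num
  · exact hT.card_le s hs

theorem multiplierSum_sub {Ω₀ Ω E : Type*} [MeasurableSpace Ω₀] {P₀ : Measure Ω₀} {X : Ω₀ → E}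
    {ξ : Ω₀ → ℝ} {N : ℕ} {Xs : Fin N → Ω → E} {ξs : Fin N → Ω → ℝ} {f g : E → ℝ}
    (hf : Integrable (fun ω => ξ ω * f (X ω)) P₀)
    (hg : Integrable (fun ω => ξ ω * g (X ω)) P₀) (ω : Ω) :
    multiplierSum P₀ X ξ Xs ξs (f - g) ω =
      multiplierSum P₀ X ξ Xs ξs f ω - multiplierSum P₀ X ξ Xs ξs g ω := by
  simp only [multiplierSum, Pi.sub_apply, mul_sub]
  rw [integral_sub hf hg, ← Finset.sum_sub_distrib]
  exact Finset.sum_congr rfl fun i _ => by ring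

namespace IsSubgaussianSample

variable {Ω₀ Ω E : Type*} [MeasurableSpace E] [MeasurableSpace Ω₀] [MeasurableSpace Ω]
  {P₀ : Measure Ω₀} {P : Measure Ω} {X : Ω₀ → E} {ξ : Ω₀ → ℝ} {N : ℕ}
  {Xs : Fin N → Ω → E} {ξs : Fin N → Ω → ℝ} {c : ℝ}

theorem integrable_of_gradedNorm_ne_top (hs : IsSubgaussianSample P₀ P X ξ Xs ξs c) {h : E → ℝ}
    (hh : Measurable h) {p : ℝ} (hp : 2 ≤ p) (hg : gradedNorm p h (P₀.map X) ≠ ∞) :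
    Integrable (fun ω => ξ ω * h (X ω)) P₀ := by
  refine (hs.integrable_mul hh hp (H := (gradedNorm p h (P₀.map X)).toReal + 1)
    (by positivity) ?_).1
  rw [ENNReal.ofReal_add (by positivity) (by norm_num), ENNReal.ofReal_toReal hg]
  exact le_self_add

theorem aemeasurable_multiplierSum (hs : IsSubgaussianSample P₀ P X ξ Xs ξs c) {h : E → ℝ}
    (hh : Measurable h) : AEMeasurable (multiplierSum P₀ X ξ Xs ξs h) P := by
  have hφ : Measurable fun z : E × ℝ => z.2 * h z.1 := measurable_snd.mul (hh.comp measurable_fst)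
  have := fun i => ((hs.ident i).comp hφ).aemeasurable_fst
  exact Finset.aemeasurable_fun_sum _ fun i _ => (this i).sub_const _

theorem lintegral_multiplierSum_le [IsProbabilityMeasure P]
    (hs : IsSubgaussianSample P₀ P X ξ Xs ξs c)
    {h : E → ℝ} (hh : Measurable h) {p : ℝ} (hp : 2 ≤ p) {H : ℝ≥0∞} (hH : H ≠ 0) (hH' : H ≠ ∞)
    (hg : gradedNorm p h (P₀.map X) ≤ H) :
    ∫⁻ ω, ENNReal.ofReal |multiplierSum P₀ X ξ Xs ξs h ω| ∂P ≤
      ENNReal.ofReal (12 * N * c) * H := by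
  have hc := hs.pos
  have hφ : Measurable fun z : E × ℝ => z.2 * h z.1 := measurable_snd.mul (hh.comp measurable_fst)
  rw [← ENNReal.ofReal_toReal hH'] at hg
  obtain ⟨hi, hb⟩ := hs.integrable_mul hh hp (ENNReal.toReal_pos hH hH') hg
  set m := ∫ ω₀, ξ ω₀ * h (X ω₀) ∂P₀ with hm
  have hmb : |m| ≤ 6 * c * H.toReal := abs_integral_le_integral_abs.trans hb
  have hid := fun i => (hs.ident i).comp hφ
  have hterm : ∀ i, Integrable (fun ω => ξs i ω * h (Xs i ω)) P := fun i =>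
    (hid i).integrable_iff.mpr hi
  have hint : Integrable (multiplierSum P₀ X ξ Xs ξs h) P :=
    integrable_finsetSum _ fun i _ => (hterm i).sub (integrable_const _)
  have hbi : ∀ i, ∫ ω, |ξs i ω * h (Xs i ω)| ∂P ≤ 6 * c * H.toReal := fun i =>
    (((hid i).comp measurable_norm).integral_eq).trans_le hb
  have hti : ∀ i, Integrable (fun ω => |ξs i ω * h (Xs i ω)| + |m|) P := fun i =>
    (hterm i).abs.add (integrable_const _)
  rw [← ofReal_integral_eq_lintegral_ofReal hint.abs (ae_of_all _ fun _ => abs_nonneg _)]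
  nth_rw 1 [← ENNReal.ofReal_toReal hH']
  rw [← ENNReal.ofReal_mul (by positivity)]
  refine ENNReal.ofReal_le_ofReal ?_
  calc ∫ ω, |multiplierSum P₀ X ξ Xs ξs h ω| ∂P
      ≤ ∫ ω, ∑ i, (|ξs i ω * h (Xs i ω)| + |m|) ∂P := by
        refine integral_mono hint.abs (integrable_finsetSum _ fun i _ => hti i) fun ω => ?_
        exact (Finset.abs_sum_le_sum_abs _ _).trans (Finset.sum_le_sum fun i _ => abs_sub _ _)
    _ = ∑ i, (∫ ω, |ξs i ω * h (Xs i ω)| ∂P + |m|) := by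
        rw [integral_finsetSum _ fun i _ => hti i]
        refine Finset.sum_congr rfl fun i _ => ?_
        rw [integral_add (hterm i).abs (integrable_const _)]
        simp
    _ ≤ ∑ _i : Fin N, (6 * c * H.toReal + 6 * c * H.toReal) :=
        Finset.sum_le_sum fun i _ => add_le_add (hbi i) hmb
    _ = 12 * N * c * H.toReal := by simp; ring

theorem measure_mul_gradedNorm_lt_le [IsProbabilityMeasure P₀] [IsProbabilityMeasure P]
    (hs : IsSubgaussianSample P₀ P X ξ Xs ξs c) {h : E → ℝ}
    (hh : Measurable h) {u w : ℝ} (hu : 8 ≤ u) (hw : 1 ≤ w) (hN : 0 < N) (s : ℕ) :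
    P ({ω | ∑ i, ξs i ω ^ 2 ≤ w ^ 2 * N * c ^ 2} ∩
        {ω | ENNReal.ofReal (54 * u * w * Real.sqrt N * c) *
          ((2 : ℝ≥0∞) ^ ((s : ℝ) / 2) * gradedNorm (u ^ 2 * 2 ^ s) h (P₀.map X)) <
          ENNReal.ofReal |multiplierSum P₀ X ξ Xs ξs h ω|}) ≤
      ENNReal.ofReal (Real.exp (-(u ^ 2 * 2 ^ s / 8))) := by
  have hc := hs.pos
  have hN' : (0 : ℝ) < N := by exact_mod_cast hN
  have hu0 : 0 < u := by linarith
  have h2s : (1 : ℝ) ≤ 2 ^ s := one_le_pow₀ (by norm_num)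
  have hp : 64 ≤ u ^ 2 * 2 ^ s := by nlinarith
  have hconst : ∀ g : ℝ≥0∞, ENNReal.ofReal (54 * u * w * Real.sqrt N * c) *
      ((2 : ℝ≥0∞) ^ ((s : ℝ) / 2) * g) =
      ENNReal.ofReal (54 * w * Real.sqrt N * Real.sqrt (u ^ 2 * 2 ^ s) * c) * g := fun g => by
    rw [show 54 * w * Real.sqrt N * Real.sqrt (u ^ 2 * 2 ^ s) * c =
        54 * w * Real.sqrt N * c * Real.sqrt (u ^ 2 * 2 ^ s) by ring,
      show 54 * u * w * Real.sqrt N * c = 54 * w * Real.sqrt N * c * u by ring,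
      ENNReal.ofReal_mul (q := u) (by positivity),
      ENNReal.ofReal_mul (q := Real.sqrt _) (by positivity), ofReal_sqrt_sq_mul_two_pow hu0.le]
    simp only [mul_assoc]
  simp only [hconst]
  refine measure_inter_mul_lt_le ENNReal.ofReal_ne_top (Or.inl ?_) fun b hb hb' => ?_
  · rw [Ne, ENNReal.ofReal_eq_zero, not_le]
    positivity
  · have hb0 : 0 < b.toReal := ENNReal.toReal_pos (ne_bot_of_gt hb) hb'
    refine (measure_mono ?_).trans (hs.measure_multiplierSum_le hh hp hw hb0
      (by rw [ENNReal.ofReal_toReal hb']; exact hb.le))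
    refine Set.inter_subset_inter_right _ fun ω hω => ?_
    simp only [Set.mem_ofPred_eq] at hω ⊢
    rw [← ENNReal.ofReal_toReal hb', ← ENNReal.ofReal_mul (by positivity)] at hω
    exact (ENNReal.ofReal_lt_ofReal_iff_of_nonneg (by positivity)).mp hω

/-- Union bound over a class whose cardinality is dominated by the Gaussian-type tail. -/
theorem measure_biUnion_le [IsProbabilityMeasure P₀] [IsProbabilityMeasure P]
    (hs : IsSubgaussianSample P₀ P X ξ Xs ξs c) {u w : ℝ} (hu : 8 ≤ u) (hw : 1 ≤ w) (hN : 0 < N)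
    (s : ℕ) {Q : Set (E → ℝ)} (hQ : ∀ h ∈ Q, Measurable h)
    (hcard : Q.encard ≤ 2 ^ (3 * 2 ^ s)) :
    P (⋃ h ∈ Q, {ω | ∑ i, ξs i ω ^ 2 ≤ w ^ 2 * N * c ^ 2} ∩
        {ω | ENNReal.ofReal (54 * u * w * Real.sqrt N * c) *
          ((2 : ℝ≥0∞) ^ ((s : ℝ) / 2) * gradedNorm (u ^ 2 * 2 ^ s) h (P₀.map X)) <
          ENNReal.ofReal |multiplierSum P₀ X ξ Xs ξs h ω|}) ≤
      ENNReal.ofReal (Real.exp (-(u ^ 2 * 2 ^ s / 16))) := by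
  have hfin : Q.Finite := Set.encard_lt_top_iff.mp (hcard.trans_lt (by
    exact_mod_cast ENat.natCast_lt_top (2 ^ (3 * 2 ^ s))))
  obtain ⟨R, rfl⟩ := hfin.exists_finset_coe
  rw [Set.encard_coe_eq_coe_finsetCard] at hcard
  have hcard' : R.card ≤ 2 ^ (3 * 2 ^ s) := by exact_mod_cast hcard
  refine (measure_biUnion_finset_le R _).trans ((Finset.sum_le_sum fun h hh =>
    hs.measure_mul_gradedNorm_lt_le (hQ h hh) hu hw hN s).trans ?_)
  rw [Finset.sum_const, nsmul_eq_mul, ← ENNReal.ofReal_natCast,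
    ← ENNReal.ofReal_mul (by positivity)]
  refine ENNReal.ofReal_le_ofReal ?_
  have h2s : (1 : ℝ) ≤ 2 ^ s := one_le_pow₀ (by norm_num)
  have h1 : (R.card : ℝ) ≤ Real.exp (3 * 2 ^ s) := by
    calc (R.card : ℝ) ≤ 2 ^ (3 * 2 ^ s) := by exact_mod_cast hcard'
      _ ≤ Real.exp 1 ^ (3 * 2 ^ s) := by
          gcongr
          linarith [Real.add_one_le_exp 1]
      _ = Real.exp (3 * 2 ^ s) := by rw [Real.exp_one_pow]; push_cast; rfl
  calc (R.card : ℝ) * Real.exp (-(u ^ 2 * 2 ^ s / 8))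
      ≤ Real.exp (3 * 2 ^ s) * Real.exp (-(u ^ 2 * 2 ^ s / 8)) := by gcongr
    _ = Real.exp (3 * 2 ^ s - u ^ 2 * 2 ^ s / 8) := by rw [← Real.exp_add, sub_eq_add_neg]
    _ ≤ _ := by
        gcongr
        nlinarith [mul_le_mul_of_nonneg_right (show 64 ≤ u ^ 2 by nlinarith)
          (show (0 : ℝ) ≤ 2 ^ s by positivity)]

end IsSubgaussianSample

/-- The deterministic part of a chaining argument. -/
theorem ofReal_abs_le_of_chain {z : ℕ → ℝ} {y : ℝ} {L R : ℝ≥0∞} {e : ℕ → ℝ≥0∞}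
    (h0 : ENNReal.ofReal |z 0| ≤ L * R)
    (hk : ∀ k, ENNReal.ofReal |z (k + 1) - z k| ≤ L * (e k + e (k + 1)))
    (hz : Tendsto z atTop (𝓝 y)) :
    ENNReal.ofReal |y| ≤ L * (2 * (∑' k, e k + R)) := by
  have hfin : ∀ K, ENNReal.ofReal |z K| ≤
      L * R + ∑ k ∈ Finset.range K, L * (e k + e (k + 1)) := by
    intro K
    induction K with
    | zero => simpa using h0
    | succ K ih =>
      rw [Finset.sum_range_succ, ← add_assoc]
      calc ENNReal.ofReal |z (K + 1)| ≤ ENNReal.ofReal (|z K| + |z (K + 1) - z K|) := by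
            refine ENNReal.ofReal_le_ofReal ?_
            calc |z (K + 1)| = |z K + (z (K + 1) - z K)| := by ring_nf
              _ ≤ _ := abs_add_le _ _
        _ = ENNReal.ofReal |z K| + ENNReal.ofReal |z (K + 1) - z K| :=
            ENNReal.ofReal_add (abs_nonneg _) (abs_nonneg _)
        _ ≤ _ := add_le_add ih (hk K)
  refine le_of_tendsto ((ENNReal.continuous_ofReal.comp continuous_abs).continuousAt.tendsto.comp
    hz) (Eventually.of_forall fun K => (hfin K).trans ?_)
  rw [← Finset.mul_sum, ← mul_add, Finset.sum_add_distrib]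
  refine mul_le_mul_right ?_ L
  have h1 : ∑ k ∈ Finset.range K, e k ≤ ∑' k, e k := ENNReal.sum_le_tsum _
  have h2 : ∑ k ∈ Finset.range K, e (k + 1) ≤ ∑' k, e k :=
    (ENNReal.sum_le_tsum _).trans (ENNReal.tsum_comp_le_tsum_of_injective
      (add_left_injective 1) e)
  calc _ ≤ R + (∑' k, e k + ∑' k, e k) := by gcongr
    _ ≤ (R + R) + (∑' k, e k + ∑' k, e k) := by gcongr; exact le_self_add
    _ = _ := by ring

theorem tsum_ofReal_exp_neg_le {x : ℝ} (hx : 4 ≤ x) :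
    ENNReal.ofReal (Real.exp (-x)) + ∑' k : ℕ, ENNReal.ofReal (Real.exp (-(x * 2 ^ k))) ≤
      ENNReal.ofReal (2 * Real.exp (-(x / 2))) := by
  set q := ENNReal.ofReal (Real.exp (-x)) with hq
  have hterm : ∀ k : ℕ, ENNReal.ofReal (Real.exp (-(x * 2 ^ k))) ≤ q * 2⁻¹ ^ k := by
    intro k
    have e2 : (2⁻¹ : ℝ≥0∞) ^ k = ENNReal.ofReal ((1 / 2) ^ k) := by
      rw [ENNReal.ofReal_pow (by norm_num), one_div, ENNReal.ofReal_inv_of_pos (by norm_num)]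
      simp
    rw [e2, hq, ← ENNReal.ofReal_mul (Real.exp_pos _).le]
    refine ENNReal.ofReal_le_ofReal ?_
    have h1 : Real.exp (-1) ≤ 1 / 2 := by
      rw [Real.exp_neg, one_div]
      exact inv_anti₀ (by norm_num) (by linarith [Real.add_one_le_exp 1])
    have h2 : (k : ℝ) + 1 ≤ 2 ^ k := by exact_mod_cast Nat.lt_two_pow_self (n := k)
    calc Real.exp (-(x * 2 ^ k)) ≤ Real.exp (-x + k * (-1)) := by
          gcongr
          nlinarith [(Nat.cast_nonneg k : (0 : ℝ) ≤ k)]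
      _ = Real.exp (-x) * Real.exp (-1) ^ k := by rw [Real.exp_add, Real.exp_nat_mul]
      _ ≤ _ := by gcongr
  have hsum : ∑' k : ℕ, ENNReal.ofReal (Real.exp (-(x * 2 ^ k))) ≤ q * 2 := by
    refine (ENNReal.tsum_le_tsum hterm).trans ?_
    rw [ENNReal.tsum_mul_left, ENNReal.tsum_geometric, ENNReal.one_sub_inv_two, inv_inv]
  refine (add_le_add le_rfl hsum).trans ?_
  have h3 : q + q * 2 = ENNReal.ofReal (3 * Real.exp (-x)) := by
    rw [ENNReal.ofReal_mul (by norm_num), ← hq]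
    norm_num
    ring
  rw [h3]
  refine ENNReal.ofReal_le_ofReal ?_
  have h4 : Real.exp (-x) = Real.exp (-(x / 2)) * Real.exp (-(x / 2)) := by
    rw [← Real.exp_add]; ring_nf
  have h5 : Real.exp (-(x / 2)) ≤ 1 / 3 := by
    rw [Real.exp_neg, one_div]
    exact inv_anti₀ (by norm_num) (by linarith [Real.add_one_le_exp (x / 2)])
  rw [h4]
  nlinarith [Real.exp_pos (-(x / 2))]

namespace IsSubgaussianSample

variable {Ω₀ Ω E : Type*} [MeasurableSpace E] [MeasurableSpace Ω₀] [MeasurableSpace Ω]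
  {P₀ : Measure Ω₀} {P : Measure Ω} {X : Ω₀ → E} {ξ : Ω₀ → ℝ} {N : ℕ}
  {Xs : Fin N → Ω → E} {ξs : Fin N → Ω → ℝ} {c : ℝ}

theorem ae_tendsto_multiplierSum [IsProbabilityMeasure P]
    (hs : IsSubgaussianSample P₀ P X ξ Xs ξs c) {f : E → ℝ} {a : ℕ → E → ℝ} {p : ℕ → ℝ}
    (hf : Measurable f) (ha : ∀ k, Measurable (a k))
    (hfi : Integrable (fun ω => ξ ω * f (X ω)) P₀)
    (hai : ∀ k, Integrable (fun ω => ξ ω * a k (X ω)) P₀) (hp : ∀ k, 2 ≤ p k)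
    (hsum : ∑' k, gradedNorm (p k) (f - a k) (P₀.map X) ≠ ∞) :
    ∀ᵐ ω ∂P, Tendsto (fun k => multiplierSum P₀ X ξ Xs ξs (a k) ω) atTop
      (𝓝 (multiplierSum P₀ X ξ Xs ξs f ω)) := by
  set g := fun k => gradedNorm (p k) (f - a k) (P₀.map X) with hg
  have hma : ∀ k, AEMeasurable
      (fun ω => ENNReal.ofReal |multiplierSum P₀ X ξ Xs ξs (f - a k) ω|) P := fun k =>
    (measurable_norm.comp_aemeasurable
      (hs.aemeasurable_multiplierSum (hf.sub (ha k)))).ennreal_ofReal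
  have hgeo : ∑' k : ℕ, (2⁻¹ : ℝ≥0∞) ^ k ≠ ∞ := by
    rw [ENNReal.tsum_geometric, ENNReal.one_sub_inv_two, inv_inv]
    simp
  have hint : ∫⁻ ω, ∑' k, ENNReal.ofReal |multiplierSum P₀ X ξ Xs ξs (f - a k) ω| ∂P ≠ ∞ := by
    rw [lintegral_tsum hma]
    refine ne_top_of_le_ne_top ?_ (ENNReal.tsum_le_tsum fun k =>
      hs.lintegral_multiplierSum_le (hf.sub (ha k)) (hp k) (H := g k + 2⁻¹ ^ k) ?_ ?_ le_self_add)
    · rw [ENNReal.tsum_mul_left, ENNReal.tsum_add]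
      exact ENNReal.mul_ne_top ENNReal.ofReal_ne_top (ENNReal.add_ne_top.mpr ⟨hsum, hgeo⟩)
    · simp
    · exact ENNReal.add_ne_top.mpr ⟨ENNReal.ne_top_of_tsum_ne_top hsum k,
        ENNReal.ne_top_of_tsum_ne_top hgeo k⟩
  have hmeas : AEMeasurable
      (fun ω => ∑' k, ENNReal.ofReal |multiplierSum P₀ X ξ Xs ξs (f - a k) ω|) P :=
    AEMeasurable.tsum hma
  filter_upwards [ae_lt_top' hmeas hint] with ω hω
  have h0 := ENNReal.tendsto_atTop_zero_of_tsum_ne_top hω.ne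
  have h1 := (ENNReal.tendsto_toReal ENNReal.zero_ne_top).comp h0
  simp only [Function.comp_def, ENNReal.toReal_ofReal (abs_nonneg _), ENNReal.toReal_zero,
    multiplierSum_sub hfi (hai _)] at h1
  have h2 := (tendsto_zero_iff_abs_tendsto_zero _).mpr h1
  have h3 := (tendsto_const_nhds (x := multiplierSum P₀ X ξ Xs ξs f ω)).sub h2
  simpa using h3

/-- The chaining bound for a fixed admissible sequence. -/
theorem measure_iSup_multiplierSum_le [IsProbabilityMeasure P₀] [IsProbabilityMeasure P]
    (hs : IsSubgaussianSample P₀ P X ξ Xs ξs c) {F : Set (E → ℝ)} (hF : ∀ f ∈ F, Measurable f)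
    {s₀ : ℕ} {u w : ℝ} (hu : 8 ≤ u) (hw : 8 ≤ w) (hN : 0 < N) {T : ℕ → Set (E → ℝ)}
    (hT : IsAdmissibleSeq F T) {π : ℕ → (E → ℝ) → E → ℝ} (hπ : ∀ s, ∀ f ∈ F, π s f ∈ T s)
    {B : ℝ≥0∞} (hB : B ≠ ∞)
    (hΛ : (⨆ f ∈ F, ∑' k : ℕ, (2 : ℝ≥0∞) ^ (((s₀ + k : ℕ) : ℝ) / 2) *
        gradedNorm (u ^ 2 * 2 ^ (s₀ + k)) (f - π (s₀ + k) f) (P₀.map X)) +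
      (2 : ℝ≥0∞) ^ ((s₀ : ℝ) / 2) * ⨆ f ∈ F, gradedNorm (u ^ 2 * 2 ^ s₀) (π s₀ f) (P₀.map X) ≤ B)
    {D : Set (E → ℝ)} (hD : D ⊆ F) (hDc : D.Countable) :
    P {ω | ENNReal.ofReal (108 * u * w * Real.sqrt N * c) * B <
        ⨆ f ∈ D, ENNReal.ofReal |multiplierSum P₀ X ξ Xs ξs f ω|} ≤
      ENNReal.ofReal (2 * Real.exp (-(1 / 32) * u ^ 2 * 2 ^ s₀) +
        2 * Real.exp (-(1 / 32) * N * w ^ 2)) := by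
  have hc := hs.pos
  have hu0 : 0 < u := by linarith
  have hmono2 : ∀ s t : ℕ, s ≤ t → (2 : ℝ≥0∞) ^ ((s : ℝ) / 2) ≤ 2 ^ ((t : ℝ) / 2) := by
    intro s t hst
    refine ENNReal.rpow_le_rpow_of_exponent_le (by norm_num) ?_
    have : (s : ℝ) ≤ t := by exact_mod_cast hst
    linarith
  have hone : ∀ s : ℕ, (1 : ℝ≥0∞) ≤ 2 ^ ((s : ℝ) / 2) := fun s => by
    simpa using hmono2 0 s (Nat.zero_le s)
  have hp : ∀ s : ℕ, 2 ≤ u ^ 2 * 2 ^ s := fun s => by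
    have : (1 : ℝ) ≤ 2 ^ s := one_le_pow₀ (by norm_num)
    nlinarith
  have hpmono : ∀ s t : ℕ, s ≤ t → u ^ 2 * 2 ^ s ≤ u ^ 2 * 2 ^ t := fun s t hst => by
    gcongr
    norm_num
  set e : (E → ℝ) → ℕ → ℝ≥0∞ := fun f k => (2 : ℝ≥0∞) ^ (((s₀ + k : ℕ) : ℝ) / 2) *
    gradedNorm (u ^ 2 * 2 ^ (s₀ + k)) (f - π (s₀ + k) f) (P₀.map X) with he
  set R : ℝ≥0∞ := (2 : ℝ≥0∞) ^ ((s₀ : ℝ) / 2) *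
    ⨆ f ∈ F, gradedNorm (u ^ 2 * 2 ^ s₀) (π s₀ f) (P₀.map X) with hR
  have hfB : ∀ f ∈ F, ∑' k, e f k + R ≤ B := fun f hf =>
    (add_le_add (le_iSup₂ (f := fun f (_ : f ∈ F) => ∑' k, e f k) f hf) le_rfl).trans hΛ
  have hRf : ∀ f ∈ F, (2 : ℝ≥0∞) ^ ((s₀ : ℝ) / 2) *
      gradedNorm (u ^ 2 * 2 ^ s₀) (π s₀ f) (P₀.map X) ≤ R := fun f hf => by
    refine mul_le_mul_right ?_ _
    exact le_iSup₂ (f := fun f (_ : f ∈ F) => gradedNorm (u ^ 2 * 2 ^ s₀) (π s₀ f) (P₀.map X)) f hf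
  have hTF : ∀ s, ∀ h ∈ T s, h ∈ F := fun s h hh => hT.subset s hh
  have hπF : ∀ s, ∀ f ∈ F, π s f ∈ F := fun s f hf => hTF s _ (hπ s f hf)
  have hge : ∀ f k, gradedNorm (u ^ 2 * 2 ^ (s₀ + k)) (f - π (s₀ + k) f) (P₀.map X) ≤ e f k :=
    fun f k => le_mul_of_one_le_left (zero_le) (hone _)
  have hgF : ∀ f ∈ F, gradedNorm (u ^ 2 * 2 ^ s₀) f (P₀.map X) ≠ ∞ := fun f hf => by
    refine ne_top_of_le_ne_top hB ?_
    calc gradedNorm (u ^ 2 * 2 ^ s₀) f (P₀.map X)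
        = gradedNorm (u ^ 2 * 2 ^ s₀) ((f - π s₀ f) + π s₀ f) (P₀.map X) := by
          rw [sub_add_cancel]
      _ ≤ _ := gradedNorm_add_le ((hF f hf).sub (hF _ (hπF s₀ f hf))) (hF _ (hπF s₀ f hf))
      _ ≤ ∑' k, e f k + R := by
          refine add_le_add ((hge f 0).trans (ENNReal.le_tsum 0)) ?_
          exact (le_mul_of_one_le_left (zero_le) (hone s₀)).trans (hRf f hf)
      _ ≤ B := hfB f hf
  have hiF : ∀ f ∈ F, Integrable (fun ω => ξ ω * f (X ω)) P₀ := fun f hf =>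
    hs.integrable_of_gradedNorm_ne_top (hF f hf) (hp s₀) (hgF f hf)
  set L := ENNReal.ofReal (54 * u * w * Real.sqrt N * c) with hL
  set good : Set Ω := {ω | ∑ i, ξs i ω ^ 2 ≤ w ^ 2 * N * c ^ 2} with hgood
  set bad : ℕ → (E → ℝ) → Set Ω := fun s h => good ∩ {ω | L * ((2 : ℝ≥0∞) ^ ((s : ℝ) / 2) *
    gradedNorm (u ^ 2 * 2 ^ s) h (P₀.map X)) < ENNReal.ofReal |multiplierSum P₀ X ξ Xs ξs h ω|}
    with hbad
  set Q : ℕ → Set (E → ℝ) := fun k =>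
    (fun q : (E → ℝ) × (E → ℝ) => q.1 - q.2) '' (T (s₀ + k + 1) ×ˢ T (s₀ + k)) with hQ
  have hQm : ∀ k, ∀ h ∈ Q k, Measurable h := by
    rintro k _ ⟨q, hq, rfl⟩
    exact (hF _ (hTF _ _ hq.1)).sub (hF _ (hTF _ _ hq.2))
  have hQc : ∀ k, (Q k).encard ≤ 2 ^ (3 * 2 ^ (s₀ + k)) := fun k => by
    refine (Set.encard_image_le _ _).trans ?_
    rw [Set.encard_prod]
    calc _ ≤ (2 : ℕ∞) ^ (2 ^ (s₀ + k + 1)) * 2 ^ (2 ^ (s₀ + k)) :=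
          mul_le_mul' (hT.encard_le _) (hT.encard_le _)
      _ = 2 ^ (3 * 2 ^ (s₀ + k)) := by rw [← pow_add]; congr 1; ring
  have hTc : (T s₀).encard ≤ 2 ^ (3 * 2 ^ s₀) := (hT.encard_le s₀).trans
    (pow_le_pow_right₀ (by norm_num) (by omega))
  have hconv : ∀ᵐ ω ∂P, ∀ f ∈ D, Tendsto (fun k => multiplierSum P₀ X ξ Xs ξs (π (s₀ + k) f) ω)
      atTop (𝓝 (multiplierSum P₀ X ξ Xs ξs f ω)) := by
    rw [ae_ball_iff hDc]
    intro f hf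
    refine hs.ae_tendsto_multiplierSum (p := fun k => u ^ 2 * 2 ^ (s₀ + k)) (hF f (hD hf))
      (fun k => hF _ (hπF _ f (hD hf))) (hiF f (hD hf)) (fun k => hiF _ (hπF _ f (hD hf)))
      (fun k => hp _) ?_
    exact ne_top_of_le_ne_top hB ((ENNReal.tsum_le_tsum (hge f)).trans
      (le_self_add.trans (hfB f (hD hf))))
  have hsub : {ω | ENNReal.ofReal (108 * u * w * Real.sqrt N * c) * B <
        ⨆ f ∈ D, ENNReal.ofReal |multiplierSum P₀ X ξ Xs ξs f ω|} ⊆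
      ({ω | w ^ 2 * N * c ^ 2 < ∑ i, ξs i ω ^ 2} ∪
        ((⋃ h ∈ T s₀, bad s₀ h) ∪ ⋃ k, ⋃ h ∈ Q k, bad (s₀ + k) h)) ∪
      {ω | ¬ ∀ f ∈ D, Tendsto (fun k => multiplierSum P₀ X ξ Xs ξs (π (s₀ + k) f) ω)
        atTop (𝓝 (multiplierSum P₀ X ξ Xs ξs f ω))} := by
    intro ω hω
    by_contra hcon
    simp only [Set.mem_union, not_or, Set.mem_iUnion, not_exists, Set.mem_ofPred_eq, not_lt,
      not_not] at hcon
    obtain ⟨⟨hg, hb0, hbk⟩, hlim⟩ := hcon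
    have hgω : ω ∈ good := hg
    have hω' : ENNReal.ofReal (108 * u * w * Real.sqrt N * c) * B <
      ⨆ f ∈ D, ENNReal.ofReal |multiplierSum P₀ X ξ Xs ξs f ω| := hω
    refine absurd hω' (not_lt.mpr ?_)
    refine iSup₂_le fun f hfD => ?_
    have hf := hD hfD
    have h108 : ENNReal.ofReal (108 * u * w * Real.sqrt N * c) = L * 2 := by
      rw [hL, ← ENNReal.ofReal_ofNat, ← ENNReal.ofReal_mul (by positivity)]
      ring_nf
    rw [h108, mul_assoc]
    refine (ofReal_abs_le_of_chain (L := L) (R := R) (e := e f) ?_ (fun k => ?_)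
      (hlim f hfD)).trans (mul_le_mul_right (mul_le_mul_right (hfB f hf) _) _)
    · have h1 : ¬ (L * _ < _) := fun h => hb0 (π s₀ f) (hπ s₀ f hf) ⟨hgω, h⟩
      exact (not_lt.mp h1).trans (mul_le_mul_right (hRf f hf) L)
    · have h1 : ¬ (L * _ < _) := fun h => hbk k (π (s₀ + k + 1) f - π (s₀ + k) f)
        ⟨(π (s₀ + k + 1) f, π (s₀ + k) f), ⟨hπ _ f hf, hπ _ f hf⟩, rfl⟩ ⟨hgω, h⟩
      rw [multiplierSum_sub (hiF _ (hπF _ f hf)) (hiF _ (hπF _ f hf))] at h1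
      refine (not_lt.mp h1).trans (mul_le_mul_right ?_ L)
      have h2 : π (s₀ + k + 1) f - π (s₀ + k) f =
          (f - π (s₀ + k) f) - (f - π (s₀ + k + 1) f) := by ring
      rw [h2]
      refine (mul_le_mul_right (gradedNorm_sub_le ((hF f hf).sub (hF _ (hπF _ f hf)))
        ((hF f hf).sub (hF _ (hπF _ f hf)))) _).trans ?_
      rw [mul_add]
      refine add_le_add le_rfl ?_
      exact mul_le_mul' (hmono2 (s₀ + k) (s₀ + (k + 1)) (by omega))
        (gradedNorm_mono (hpmono (s₀ + k) (s₀ + k + 1) (by omega)) _)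
  refine (measure_mono hsub).trans ((measure_union_le _ _).trans ?_)
  rw [show P {ω | ¬ ∀ f ∈ D, Tendsto (fun k => multiplierSum P₀ X ξ Xs ξs (π (s₀ + k) f) ω)
        atTop (𝓝 (multiplierSum P₀ X ξ Xs ξs f ω))} = 0 from hconv, add_zero]
  refine (measure_union_le _ _).trans ?_
  rw [add_comm, ENNReal.ofReal_add (by positivity) (by positivity)]
  refine add_le_add ?_ ?_
  · refine (measure_union_le _ _).trans ((add_le_add
      (hs.measure_biUnion_le hu (by linarith) hN s₀ (fun h hh => hF h (hTF _ h hh)) hTc)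
      ((measure_iUnion_le _).trans (ENNReal.tsum_le_tsum fun k =>
        hs.measure_biUnion_le hu (by linarith) hN (s₀ + k) (hQm k) (hQc k)))).trans ?_)
    have hx : 4 ≤ u ^ 2 * 2 ^ s₀ / 16 := by
      have : (1 : ℝ) ≤ 2 ^ s₀ := one_le_pow₀ (by norm_num)
      nlinarith
    refine le_trans (le_of_eq ?_) ((tsum_ofReal_exp_neg_le hx).trans (le_of_eq ?_))
    · congr 1
      refine tsum_congr fun k => ?_
      rw [pow_add]
      ring_nf
    · ring_nf
  · refine (hs.measure_lt_sum_sq_le (by nlinarith)).trans (ENNReal.ofReal_le_ofReal ?_)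
    have h1 : Real.exp (-(N * w ^ 2 / 2)) ≤ Real.exp (-(1 / 32) * N * w ^ 2) := by
      gcongr
      nlinarith [mul_nonneg (Nat.cast_nonneg N : (0 : ℝ) ≤ N) (sq_nonneg w)]
    linarith [Real.exp_pos (-(1 / 32) * N * w ^ 2)]

end IsSubgaussianSample

theorem exists_of_psiNorm_lt {Ω : Type*} [MeasurableSpace Ω] {α : ℝ} {f : Ω → ℝ} {μ : Measure Ω}
    {b : ℝ≥0∞} (h : psiNorm α f μ < b) :
    ∃ c : ℝ, 0 < c ∧ ∫⁻ ω, ENNReal.ofReal (Real.exp (|f ω / c| ^ α)) ∂μ ≤ 2 ∧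
      ENNReal.ofReal c < b := by
  simp only [psiNorm, iInf_lt_iff] at h
  obtain ⟨c, hc, hi, hb⟩ := h
  exact ⟨c, hc, hi, hb⟩

theorem ae_eq_zero_of_psiNorm_two_eq_zero {Ω : Type*} [MeasurableSpace Ω] {P : Measure Ω}
    {ξ : Ω → ℝ} (hξ : Measurable ξ) (h : psiNorm 2 ξ P = 0) : ∀ᵐ ω ∂P, ξ ω = 0 := by
  have key : ∀ b : ℝ, 0 < b → ∃ c, 0 < c ∧ c < b ∧ Integrable (fun ω => ξ ω ^ 2) P ∧
      ∫ ω, ξ ω ^ 2 ∂P ≤ 2 * c ^ 2 := fun b hb => by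
    obtain ⟨c, hc, hi, hcb⟩ := exists_of_psiNorm_lt (b := ENNReal.ofReal b)
      (by rw [h]; simpa using hb)
    obtain ⟨e1, e2⟩ := integrable_exp_sq_of_lintegral_le hξ hi
    obtain ⟨a1, a2⟩ := integrable_div_pow_of_exp_sq hξ e1 e2 1
    simp only [mul_one, Nat.factorial_one, Nat.cast_one, div_pow] at a1 a2
    refine ⟨c, hc, (ENNReal.ofReal_lt_ofReal_iff hb).mp hcb, ?_, ?_⟩
    · convert a1.mul_const (c ^ 2) using 2
      field_simp
    · rwa [integral_div, div_le_iff₀ (by positivity)] at a2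
  obtain ⟨-, -, -, hint, -⟩ := key 1 one_pos
  have hnn : 0 ≤ ∫ ω, ξ ω ^ 2 ∂P := integral_nonneg fun ω => sq_nonneg _
  have hzero : ∫ ω, ξ ω ^ 2 ∂P = 0 := by
    by_contra hne
    have hpos := lt_of_le_of_ne hnn (Ne.symm hne)
    obtain ⟨c, hc, hcb, -, hle⟩ := key (Real.sqrt ((∫ ω, ξ ω ^ 2 ∂P) / 2))
      (Real.sqrt_pos.mpr (by positivity))
    have := (Real.lt_sqrt hc.le).mp hcb
    linarith
  rw [integral_eq_zero_iff_of_nonneg (fun ω => sq_nonneg _) hint] at hzero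
  filter_upwards [hzero] with ω hω
  simpa using hω

theorem ae_multiplierSum_eq_zero {Ω₀ Ω E : Type*} [MeasurableSpace E] [MeasurableSpace Ω₀]
    [MeasurableSpace Ω] {P₀ : Measure Ω₀} {P : Measure Ω} {X : Ω₀ → E} {ξ : Ω₀ → ℝ} {N : ℕ}
    {Xs : Fin N → Ω → E} {ξs : Fin N → Ω → ℝ}
    (hid : ∀ i, IdentDistrib (fun ω => (Xs i ω, ξs i ω)) (fun ω => (X ω, ξ ω)) P P₀)
    (h : ∀ᵐ ω ∂P₀, ξ ω = 0) :
    ∀ᵐ ω ∂P, ∀ f, multiplierSum P₀ X ξ Xs ξs f ω = 0 := by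
  have hi : ∀ i, ∀ᵐ ω ∂P, ξs i ω = 0 := fun i =>
    (hid i).symm.ae_snd (p := fun z : E × ℝ => z.2 = 0)
      (measurable_snd (measurableSet_singleton (0 : ℝ))) h
  filter_upwards [ae_all_iff.mpr hi] with ω hω f
  have h0 : ∫ ω₀, ξ ω₀ * f (X ω₀) ∂P₀ = 0 := integral_eq_zero_of_ae (by
    filter_upwards [h] with ω₀ h₀
    simp [h₀])
  simp [multiplierSum, hω, h0]

theorem mainTheorem3 :
    ∃ c₁ c₂ : ℝ, 0 < c₁ ∧ 0 < c₂ ∧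
      ∀ (E : Type*) [MeasurableSpace E]
        (Ω₀ : Type*) [MeasurableSpace Ω₀] (P₀ : Measure Ω₀) [IsProbabilityMeasure P₀]
        (Ω : Type*) [MeasurableSpace Ω] (P : Measure Ω) [IsProbabilityMeasure P]
        (X : Ω₀ → E) (ξ : Ω₀ → ℝ) (_ : Measurable X) (_ : Measurable ξ)
        (_ : psiNorm 2 ξ P₀ < ∞)
        (N : ℕ) (Xs : Fin N → Ω → E) (ξs : Fin N → Ω → ℝ)
        (_ : iIndepFun (fun i ω => (Xs i ω, ξs i ω)) P)
        (_ : ∀ i, IdentDistrib (fun ω => (Xs i ω, ξs i ω)) (fun ω => (X ω, ξ ω)) P P₀)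
        (F : Set (E → ℝ)) (_ : ∀ f ∈ F, Measurable f)
        (s₀ : ℕ) (u w : ℝ) (_ : 8 ≤ u) (_ : 8 ≤ w)
        (G : Set (E → ℝ)) (_ : G ⊆ F)
        (_ : SupCountablyDetermined P (multiplierSum P₀ X ξ Xs ξs) G),
        P {ω | ENNReal.ofReal (c₂ * u * w * Real.sqrt N) * psiNorm 2 ξ P₀ *
                LambdaTilde (P₀.map X) s₀ u F <
              ⨆ f ∈ G, ENNReal.ofReal |multiplierSum P₀ X ξ Xs ξs f ω|} ≤
          ENNReal.ofReal (2 * Real.exp (-c₁ * u ^ 2 * 2 ^ s₀) + 2 * Real.exp (-c₁ * N * w ^ 2)) := by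
  refine ⟨1 / 32, 108, by norm_num, by norm_num, ?_⟩
  intro E _ Ω₀ _ P₀ _ Ω _ P _ X ξ hX hξ hψ N Xs ξs hind hid F hF s₀ u w hu hw G hG hsep
  rcases Nat.eq_zero_or_pos N with rfl | hN
  · refine prob_le_one.trans (ENNReal.one_le_ofReal.mpr ?_)
    have := Real.exp_pos (-(1 / 32) * u ^ 2 * 2 ^ s₀)
    simp only [Nat.cast_zero, mul_zero, zero_mul, Real.exp_zero]
    linarith
  obtain ⟨D, hDG, hDc, hD⟩ := hsep
  set S : Ω → ℝ≥0∞ := fun ω => ⨆ f ∈ D, ENNReal.ofReal |multiplierSum P₀ X ξ Xs ξs f ω| with hS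
  set K := ENNReal.ofReal (108 * u * w * Real.sqrt N) with hK
  have hN' : (0 : ℝ) < N := by exact_mod_cast hN
  have hK0 : K ≠ 0 := by
    rw [hK, Ne, ENNReal.ofReal_eq_zero, not_le]
    have : 0 < Real.sqrt N := Real.sqrt_pos.mpr hN'
    have : 0 < u := by linarith
    have : 0 < w := by linarith
    positivity
  have hKt : K ≠ ∞ := ENNReal.ofReal_ne_top
  have hred : P {ω | K * psiNorm 2 ξ P₀ * LambdaTilde (P₀.map X) s₀ u F <
      ⨆ f ∈ G, ENNReal.ofReal |multiplierSum P₀ X ξ Xs ξs f ω|} ≤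
      P (Set.univ ∩ {ω | K * psiNorm 2 ξ P₀ * LambdaTilde (P₀.map X) s₀ u F < S ω}) := by
    refine measure_mono_ae ?_
    filter_upwards [hD] with ω hω h
    refine ⟨trivial, ?_⟩
    have h' : K * psiNorm 2 ξ P₀ * LambdaTilde (P₀.map X) s₀ u F <
      ⨆ f ∈ G, ENNReal.ofReal |multiplierSum P₀ X ξ Xs ξs f ω| := h
    rw [hω] at h'
    exact h'
  refine hred.trans ?_
  rcases eq_or_ne (psiNorm 2 ξ P₀) 0 with hz | hz
  · have hae := ae_multiplierSum_eq_zero hid (ae_eq_zero_of_psiNorm_two_eq_zero hξ hz)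
    refine (measure_mono_null (t := {ω | ¬ ∀ f, multiplierSum P₀ X ξ Xs ξs f ω = 0})
      (fun ω hω hcon => ?_) hae).trans_le zero_le
    have h' : K * psiNorm 2 ξ P₀ * LambdaTilde (P₀.map X) s₀ u F < S ω := hω.2
    simp [hS, hcon] at h'
  refine measure_inter_mul_lt_le (ENNReal.mul_ne_top hKt hψ.ne)
    (Or.inl (mul_ne_zero hK0 hz)) fun B hB hBt => ?_
  simp only [LambdaTilde, iInf_lt_iff] at hB
  obtain ⟨T, hT, π, hπ, hΛ⟩ := hB
  simp only [mul_right_comm K _ B]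
  refine measure_inter_mul_lt_le (ENNReal.mul_ne_top hKt hBt) (Or.inr hψ.ne) fun b hb _ => ?_
  obtain ⟨c, hc, hexp, hcb⟩ := exists_of_psiNorm_lt hb
  have hs : IsSubgaussianSample P₀ P X ξ Xs ξs c := ⟨hX, hξ, hind, hid, hc, hexp⟩
  refine (measure_mono fun ω hω => ?_).trans (hs.measure_iSup_multiplierSum_le hF hu hw hN hT
    (fun s f hf => (hπ s f hf).1) hBt hΛ.le (hDG.trans hG) hDc)
  have h' : K * B * b < S ω := hω.2
  refine lt_of_le_of_lt ?_ h'
  rw [ENNReal.ofReal_mul (by positivity), mul_right_comm]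
  gcongr
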